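/- A \emph{linking pairing} on a finite abelian group $G$ is a symmetric bilinear form $\lambda: G\times G\to\mathbb{Q}/\mathbb{Z}$ whose adjoint homomorphism $G\to\mathrm{Hom}(G,\mathbb{Q}/\mathbb{Z})$ is bijective. If $G$ is a finite abelian $2$-group, then $(G,\lambda)$ has an orthogonal decomposition $\bigoplus_{k\ge 1}(G_k,\lambda_k)$ with $G_k$ a free $\mathbb{Z}/2^k\mathbb{Z}$-module; for $k\geq 1$ let $\rho_k(\lambda)\in\mathbb{N}$ be the rank of $G_k$ (it does not depend on the decomposition), and let $$\Gamma_k(\lambda)=\sum_{x\in G}\exp\bigl(\sqrt{-1}\,\pi\,2^k\lambda(x,x)\bigr).$$ If $\Gamma_k(\lambda)\neq 0$, then $\Gamma_k(\lambda)/|\Gamma_k(\lambda)|$ is an $8$th root of unity. Put $\overline{\mathbb{Z}}_8=\mathbb{Z}/8\mathbb{Z}\cup\{\infty\}$, with $\infty$ absorbing for addition, and let $\sigma_k(\lambda)\in\overline{\mathbb{Z}}_8$ be $\infty$ if $\Gamma_k(\lambda)=0$, and otherwise the element $j\in\mathbb{Z}/8\mathbb{Z}$ with $\Gamma_k(\lambda)/|\Gamma_k(\lambda)|=\exp(2\pi\sqrt{-1}\,j/8)$.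 Let $\mathbb{N}^\times=\{1,2,3,\dots\}$ and let $T:\mathbb{N}^\times\to\mathbb{N}\times\overline{\mathbb{Z}}_8$, $m\mapsto(r(m),s(m))$, be a finite tableau, that is, $T(m)=(0,0)$ for all but finitely many $m$. Call $T$ \emph{admissible} if there is a linking pairing $\lambda$ on a finite abelian $2$-group with $r(m)=\rho_m(\lambda)$ and $s(m)=\sigma_m(\lambda)$ for all $m\geq 1$. Call $m\in\mathbb{N}^\times$ \emph{regular} if $r(m)=0$ or $s(m)\neq\infty$. A congruence for, or a condition on a difference of, elements of $\overline{\mathbb{Z}}_8$ includes the assertion that these elements are different from $\infty$. \textbf{Theorem.} A finite tableau $T$ is admissible if and only if the following four conditions hold. \begin{enumerate} \item[(1)] $r(m)$ is even for every regular $m$. \item[(2)] $s(m)\equiv\sum_{k\geq m+1}r(k)\pmod 2$ for every regular $m$. \item[(3)] $s(m)+s(m+1)\equiv 2\sum_{k\geq m+2}r(k)\pmod 4$ whenever $m$ and $m+1$ are both regular. \item[(4)] Let $I\subset\mathbb{N}^\times$ be a non-empty finite set of consecutive integers such that its delimiters $m=\min I-1$ and $n=\max I+1$ both lie in $\mathbb{N}^\times$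 and are regular. Then \begin{itemize} \item (type $T_0$) if $|I|$ is odd and $r(i)=0$ for all $i\in I$, then $s(m)-s(n)=0$; \item (type $T_1$) if $I=\{i\}$ and $(r(i),s(i))=(1,\infty)$, then $s(m)-s(n)\in\{1,-1\}$; \item (type $T_2$) if $I=\{i\}$ and $(r(i),s(i))=(2,\infty)$, then $s(m)-s(n)\in\{0,2,-2\}$; \item (type $T_3$) if $|I|$ is odd and every $i\in I$ is regular, then $s(m)-s(n)\in\{0,4\}$. \end{itemize} \end{enumerate} -/

import Mathlib

namespace Enlacement

noncomputable section

/-! ### Linking pairings and their invariants -/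

/-- The group `ℚ/ℤ`. -/
abbrev QmodZ : Type := AddCircle (1 : ℚ)

/-- A linking pairing on an abelian group `G` (used for finite `G`): a symmetric bilinear form
`G × G → ℚ/ℤ` whose adjoint homomorphism `G → Hom(G, ℚ/ℤ)` is bijective. -/
structure LinkingPairing (G : Type*) [AddCommGroup G] where
  /-- the adjoint homomorphism, i.e. the pairing itself in curried form -/
  form : G →+ G →+ QmodZ
  symm : ∀ x y : G, form x y = form y x
  bijective_adjoint : Function.Bijective form

/-- The monoid `ℤ/8 ∪ {∞}`; `∞ = ⊤` is absorbing for addition. -/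
abbrev Z8bar : Type := WithTop (ZMod 8)

/-- For `k ≥ 1` the function `q ↦ exp(√-1 π 2^k q)` is `1`-periodic on `ℚ`. -/
theorem periodic_exp (k : ℕ+) :
    Function.Periodic
      (fun q : ℚ => Complex.exp (Complex.I * Real.pi * 2 ^ (k : ℕ) * (q : ℂ))) 1 := by
  intro q
  obtain ⟨j, hj⟩ : ∃ j : ℕ, (k : ℕ) = j + 1 := ⟨k.natPred, (PNat.natPred_add_one k).symm⟩
  have h : Complex.I * Real.pi * 2 ^ (k : ℕ) * ((q + 1 : ℚ) : ℂ)
      = Complex.I * Real.pi * 2 ^ (k : ℕ) * (q : ℂ)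
        + ((2 ^ j : ℕ) : ℂ) * (2 * Real.pi * Complex.I) := by
    rw [hj]; push_cast; ring
  simp only [h]
  exact Complex.exp_periodic.nat_mul (2 ^ j) _

/-- `t ↦ exp(√-1 π 2^k t)` as a function on `ℚ/ℤ`, for `k ≥ 1`. -/
def phase (k : ℕ+) : QmodZ → ℂ := (periodic_exp k).lift

section Invariants

variable {G : Type*} [AddCommGroup G]

/-- The Gauss sum `Γ_k(G, λ) = ∑_{x ∈ G} exp(√-1 π 2^k λ(x, x))`. -/
def gaussSum [Fintype G] (l : LinkingPairing G) (k : ℕ+) : ℂ :=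
  ∑ x : G, phase k (l.form x x)

open Classical in
/-- The invariant `σ_k(λ) ∈ ℤ/8 ∪ {∞}`. It is `∞` if `Γ_k = 0`. Otherwise it is the unique
`j ∈ ℤ/8` with `Γ_k / |Γ_k| = exp(2π√-1 j / 8)`, that is, the argument of `Γ_k`, counted in
multiples of `2π / 8`; `ZMod.stdAddChar j` is `exp(2π√-1 j / 8)`. -/
def sigma [Fintype G] (l : LinkingPairing G) (k : ℕ+) : Z8bar :=
  if gaussSum l k = 0 then ⊤
  else ((Classical.epsilon fun j : ZMod 8 =>
    gaussSum l k / (‖gaussSum l k‖ : ℂ) = ZMod.stdAddChar j : ZMod 8) : Z8bar)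

theorem sigma_eq_coe [Fintype G] (l : LinkingPairing G) (k : ℕ+) (j : ZMod 8)
    (h0 : gaussSum l k ≠ 0)
    (hj : gaussSum l k / (‖gaussSum l k‖ : ℂ) = ZMod.stdAddChar j) :
    sigma l k = (j : Z8bar) := by
  have h := Classical.epsilon_spec
    (p := fun j : ZMod 8 => gaussSum l k / (‖gaussSum l k‖ : ℂ) = ZMod.stdAddChar j) ⟨j, hj⟩
  rw [sigma, if_neg h0]
  congr 1
  exact ZMod.injective_stdAddChar (h.symm.trans hj)

/-- `H` is an orthogonal decomposition `(G, λ) = ⨁_{k ≥ 1} (G_k, λ_k)` with `G_k = H k` a free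
`ℤ/2^k`-module of finite rank (the restrictions `λ_k` of `λ` are then automatically
nondegenerate). -/
structure IsHomogeneousDecomposition (l : LinkingPairing G) (H : ℕ+ → AddSubgroup G) :
    Prop where
  isInternal : DirectSum.IsInternal H
  orthogonal : ∀ i j : ℕ+, i ≠ j → ∀ x ∈ H i, ∀ y ∈ H j, l.form x y = 0
  free : ∀ k : ℕ+, ∃ n : ℕ, Nonempty (H k ≃+ (Fin n → ZMod (2 ^ (k : ℕ))))

/-- The invariant `ρ_k(λ)` of a linking pairing on a finite `2`-group: the rank of the free
`ℤ/2^k`-module `G_k` in an orthogonal decomposition of `(G, λ)` into homogeneous pieces. -/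
def rho (l : LinkingPairing G) (k : ℕ+) : ℕ :=
  Classical.epsilon fun n : ℕ => ∃ H : ℕ+ → AddSubgroup G,
    IsHomogeneousDecomposition l H ∧ Nonempty (H k ≃+ (Fin n → ZMod (2 ^ (k : ℕ))))

end Invariants

/-! ### Tableaux -/

/-- A tableau on a set `I` of positive integers: `m ↦ (r(m), s(m))`. -/
abbrev Tableau (I : Set ℕ+) : Type := I → ℕ × Z8bar

/-- A tableau on all positive integers. -/
abbrev FullTableau : Type := ℕ+ → ℕ × Z8bar

/-- The formal rank `r(m)`. -/
abbrev FullTableau.r (T : FullTableau) (m : ℕ+) : ℕ := (T m).1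

/-- The formal signature `s(m)`. -/
abbrev FullTableau.s (T : FullTableau) (m : ℕ+) : Z8bar := (T m).2

/-- A tableau on all positive integers is finite if it has finite support. -/
def FullTableau.IsFinite (T : FullTableau) : Prop := (Function.support T).Finite

/-- The tableau on `I` extracted from `T`. -/
def FullTableau.extract (T : FullTableau) (I : Set ℕ+) : Tableau I := fun m => T m

/-- `T` is admissible if it is the tableau `k ↦ (ρ_k(λ), σ_k(λ))` of a linking pairing `λ` on
some finite abelian `2`-group. -/
def FullTableau.Admissible (T : FullTableau) : Prop :=
  ∃ (G : Type) (_ : AddCommGroup G) (_ : Fintype G) (l : LinkingPairing G),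
    (∃ n : ℕ, Nat.card G = 2 ^ n) ∧ ∀ m : ℕ+, T.r m = rho l m ∧ T.s m = sigma l m

/-- An index with entry `(r, s)` is regular if `r = 0` or `s ≠ ∞`. -/
def IsRegularEntry (e : ℕ × Z8bar) : Prop := e.1 = 0 ∨ e.2 ≠ ⊤

/-- The regular indices of a tableau. -/
def FullTableau.IsRegular (T : FullTableau) (m : ℕ+) : Prop := IsRegularEntry (T m)

/-- Type `T₀`: odd length, all formal ranks equal to `0`. -/
def Tableau.IsType0 {I : Set ℕ+} (T : Tableau I) : Prop :=
  Odd I.ncard ∧ ∀ m : I, (T m).1 = 0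

/-- Type `T₁`: a single column `(1, ∞)`. -/
def Tableau.IsType1 {I : Set ℕ+} (T : Tableau I) : Prop :=
  I.ncard = 1 ∧ ∀ m : I, T m = (1, ⊤)

/-- Type `T₂`: a single column `(2, ∞)`. -/
def Tableau.IsType2 {I : Set ℕ+} (T : Tableau I) : Prop :=
  I.ncard = 1 ∧ ∀ m : I, T m = (2, ⊤)

/-- Type `T₃`: odd length, all indices regular. -/
def Tableau.IsType3 {I : Set ℕ+} (T : Tableau I) : Prop :=
  Odd I.ncard ∧ ∀ m : I, IsRegularEntry (T m)

/-- `m` is the left delimiter `inf I - 1` of `I`. -/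
def IsLeftDelimiter (I : Set ℕ+) (m : ℕ+) : Prop := IsLeast I (m + 1)

/-- `n` is the right delimiter `sup I + 1` of `I`. -/
def IsRightDelimiter (I : Set ℕ+) (n : ℕ+) : Prop := ∃ b : ℕ+, IsGreatest I b ∧ n = b + 1

/-- `a ≡ n (mod d)`, for `d ∣ 8`: `a` is not `∞` and reduces to `n` modulo `d`. -/
def CongrMod (d : ℕ) (a : Z8bar) (n : ℕ) : Prop :=
  ∃ x : ZMod 8, a = (x : Z8bar) ∧ (x.cast : ZMod d) = (n : ZMod d)

/-- `a - b ∈ D`; in particular `a` and `b` are not `∞`. -/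
def DiffMem (a b : Z8bar) (D : Set (ZMod 8)) : Prop :=
  ∃ x y : ZMod 8, a = (x : Z8bar) ∧ b = (y : Z8bar) ∧ x - y ∈ D

/-- Condition (1): the formal rank is even at regular indices. -/
def FullTableau.Cond1 (T : FullTableau) : Prop :=
  ∀ m : ℕ+, T.IsRegular m → Even (T.r m)

/-- Condition (2): `s(m) ≡ ∑_{k ≥ m+1} r(k) (mod 2)` at regular indices. -/
def FullTableau.Cond2 (T : FullTableau) : Prop :=
  ∀ m : ℕ+, T.IsRegular m → CongrMod 2 (T.s m) (∑ᶠ (k : ℕ+) (_ : m + 1 ≤ k), T.r k)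

/-- Condition (3): `s(m) + s(m+1) ≡ 2 ∑_{k ≥ m+2} r(k) (mod 4)` if `m`, `m+1` are regular. -/
def FullTableau.Cond3 (T : FullTableau) : Prop :=
  ∀ m : ℕ+, T.IsRegular m → T.IsRegular (m + 1) →
    CongrMod 4 (T.s m + T.s (m + 1)) (2 * ∑ᶠ (k : ℕ+) (_ : m + 2 ≤ k), T.r k)

/-- Condition (4): the constraints on `s(m) - s(n)` for the delimiters `m`, `n` of an extracted
tableau (on a set of consecutive integers), if both delimiters are regular indices. -/
def FullTableau.Cond4 (T : FullTableau) : Prop :=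
  ∀ I : Set ℕ+, I.OrdConnected → ∀ m n : ℕ+, IsLeftDelimiter I m → IsRightDelimiter I n →
    T.IsRegular m → T.IsRegular n →
    ((T.extract I).IsType0 → DiffMem (T.s m) (T.s n) {0}) ∧
    ((T.extract I).IsType1 → DiffMem (T.s m) (T.s n) {1, -1}) ∧
    ((T.extract I).IsType2 → DiffMem (T.s m) (T.s n) {0, 2, -2}) ∧
    ((T.extract I).IsType3 → DiffMem (T.s m) (T.s n) {0, 4})

end

end Enlacement

/-! Every linking pairing on a finite abelian 2-group is an orthogonal sum of blocks over `ℤ/2^k` of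
two kinds: odd blocks `(2j+1)` of rank one, and even blocks with rows `(2a, 1)`, `(1, 2c)` of rank
two (`exists_isSumOfBlocks`). Ranks add and Gauss sums multiply, so everything rests on the
contribution of one block at `k` to `σ_m` (`Block.gaussSum_hasPhase`). An odd block with `k = m`
contributes `∞`. Otherwise the contribution is `0` if `k ≤ m`, a constant `u` if `k - m` is positive
and odd, and a constant `v` if it is positive and even. For an odd block, `u = ±1` records `2j+1`
modulo 4 and `v` is its class modulo 8, so `v` is `u` or `u + 4`; for an even block, `u` is `0` or
`4` and `v = 0`. Thus `admissible_iff_exists_blocks` leaves a combinatorial problem about triples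
(rank, `u`, `v`).

Necessity: a regular column contains only even blocks, whence (1). Modulo 2 both `u` and `v` equal
the rank, whence (2), and modulo 4 `u + v` is twice the rank, whence (3). If `n - m` is even, a
block beyond `n` contributes equally to `σ_m` and `σ_n`, and an even block at `n` contributes `0` to
both; so `s(m) - s(n)` is a sum over the blocks strictly between, whence (4).

Sufficiency is a descending induction on columns (`Realizes.exists_pred`). With the columns beyond
`k` filled, the total `u` of column `k` is forced by `s(k-1)` when `k-1` is regular, and its total
`v` enters `s(k-2)`. If `k` is regular then `v = 0`, and column `k-1` will have to supply `s(k-2) -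
s(k)`, which is attainable by (4) for `I = {k-1}`. If `k` is irregular, `v` may be either `u` or `u
+ 4`, and with (2) and (3) this freedom makes the demand on column `k-1` attainable. Only singletons
`I` in (4) are used in this direction. -/

namespace Enlacement

noncomputable section

/-! ### Finite cyclic subgroups of `ℚ/ℤ` -/

/-- The embedding `ℤ/N → ℚ/ℤ`, `x ↦ x / N`. -/
def toQ (N : ℕ) [NeZero N] : ZMod N →+ QmodZ :=
  ZMod.lift N ⟨zmultiplesHom QmodZ (((1 : ℚ) / N : ℚ) : QmodZ), by
    have hN : (N : ℚ) ≠ 0 := Nat.cast_ne_zero.mpr (NeZero.ne N)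
    rw [zmultiplesHom_apply, ← AddCircle.coe_zsmul, AddCircle.coe_eq_zero_iff]
    exact ⟨1, by simp [hN]⟩⟩

theorem toQ_intCast (N : ℕ) [NeZero N] (z : ℤ) :
    toQ N (z : ZMod N) = (((z : ℚ) / N : ℚ) : QmodZ) := by
  rw [toQ, ZMod.lift_coe]
  simp only [zmultiplesHom_apply]
  rw [← AddCircle.coe_zsmul]
  congr 1
  simp [div_eq_mul_inv]

theorem toQ_injective (N : ℕ) [NeZero N] : Function.Injective (toQ N) := by
  rw [injective_iff_map_eq_zero]
  intro a ha
  obtain ⟨z, rfl⟩ := ZMod.intCast_surjective a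
  have hN : (N : ℚ) ≠ 0 := Nat.cast_ne_zero.mpr (NeZero.ne N)
  rw [toQ_intCast, AddCircle.coe_eq_zero_iff] at ha
  obtain ⟨n, hn⟩ := ha
  rw [ZMod.intCast_zmod_eq_zero_iff_dvd]
  refine ⟨n, ?_⟩
  rw [zsmul_one, eq_div_iff hN] at hn
  have : (z : ℚ) = ((N * n : ℤ) : ℚ) := by push_cast; linarith
  exact_mod_cast this

/-- Lets homomorphisms from a group killed by `N` to `ℚ/ℤ` be treated as `ℤ/N`-valued, so that
linear algebra over `ℤ/N` applies. -/
theorem exists_toQ_eq (N : ℕ) [NeZero N] (t : QmodZ) (ht : N • t = 0) : ∃ a, toQ N a = t := by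
  obtain ⟨q, rfl⟩ := QuotientAddGroup.mk_surjective t
  have hN : (N : ℚ) ≠ 0 := Nat.cast_ne_zero.mpr (NeZero.ne N)
  have h' : ((N • q : ℚ) : QmodZ) = 0 := by rw [AddCircle.coe_nsmul]; exact ht
  rw [AddCircle.coe_eq_zero_iff] at h'
  obtain ⟨n, hn⟩ := h'
  refine ⟨(n : ZMod N), ?_⟩
  rw [toQ_intCast]
  have : (n : ℚ) / N = q := by
    rw [div_eq_iff hN]
    simp only [zsmul_eq_mul, mul_one, nsmul_eq_mul] at hn
    rw [hn, mul_comm]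
  rw [this]

theorem toQ_mul {N : ℕ} [NeZero N] (c a : ZMod N) : toQ N (c * a) = c.val • toQ N a := by
  rw [← map_nsmul, nsmul_eq_mul, ZMod.natCast_zmod_val]

/-! ### Phases and Gauss sums -/

theorem phase_coe (k : ℕ+) (q : ℚ) :
    phase k (q : QmodZ) = Complex.exp (Complex.I * Real.pi * 2 ^ (k : ℕ) * (q : ℂ)) :=
  Function.Periodic.lift_coe _ q

theorem phase_zero (k : ℕ+) : phase k 0 = 1 := by
  rw [← AddCircle.coe_zero, phase_coe]; simp

theorem phase_add (k : ℕ+) (s t : QmodZ) : phase k (s + t) = phase k s * phase k t := by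
  obtain ⟨p, rfl⟩ := QuotientAddGroup.mk_surjective s
  obtain ⟨q, rfl⟩ := QuotientAddGroup.mk_surjective t
  have h : ((p : QmodZ) + (q : QmodZ)) = ((p + q : ℚ) : QmodZ) := rfl
  change phase k ((p : QmodZ) + (q : QmodZ)) = phase k (p : QmodZ) * phase k (q : QmodZ)
  rw [h, phase_coe, phase_coe, phase_coe, ← Complex.exp_add]
  congr 1; push_cast; ring

theorem phase_sum {ι : Type*} (s : Finset ι) (k : ℕ+) (f : ι → QmodZ) :
    phase k (∑ i ∈ s, f i) = ∏ i ∈ s, phase k (f i) := by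
  classical
  induction s using Finset.induction_on with
  | empty => simp [phase_zero]
  | insert a s ha ih => rw [Finset.sum_insert ha, Finset.prod_insert ha, phase_add, ih]

theorem gaussSum_congr {G G' : Type*} [AddCommGroup G] [Fintype G] [AddCommGroup G'] [Fintype G']
    (l : LinkingPairing G) (l' : LinkingPairing G') (e : G ≃+ G')
    (he : ∀ x y, l.form x y = l'.form (e x) (e y)) (k : ℕ+) : gaussSum l k = gaussSum l' k :=
  Fintype.sum_equiv e.toEquiv _ _ fun x => by rw [he]; rfl

/-! ### Orthogonal sums and matrices -/

/-- The orthogonal sum of a finite family of linking pairings. -/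
def LinkingPairing.pi {ι : Type*} [Fintype ι] {G : ι → Type*}
    [∀ i, AddCommGroup (G i)] (l : ∀ i, LinkingPairing (G i)) : LinkingPairing (∀ i, G i) where
  form := ∑ i, ((l i).form.compl₂ (Pi.evalAddMonoidHom G i)).comp (Pi.evalAddMonoidHom G i)
  symm x y := by
    simp only [AddMonoidHom.finsetSum_apply, AddMonoidHom.comp_apply, AddMonoidHom.compl₂_apply,
      Pi.evalAddMonoidHom_apply]
    exact Finset.sum_congr rfl fun i _ => (l i).symm _ _
  bijective_adjoint := by
    classical
    -- Pairing with vectors supported at one index isolates one component, so bijectivity can be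
    -- checked componentwise.
    have key (x : ∀ i, G i) (i : ι) (z : G i) :
        (∑ i, ((l i).form.compl₂ (Pi.evalAddMonoidHom G i)).comp (Pi.evalAddMonoidHom G i)) x
          (Pi.single i z) = (l i).form (x i) z := by
      simp only [AddMonoidHom.finsetSum_apply, AddMonoidHom.comp_apply, AddMonoidHom.compl₂_apply,
        Pi.evalAddMonoidHom_apply]
      rw [Finset.sum_eq_single i]
      · simp
      · intro j _ hj; simp [Pi.single_eq_of_ne hj]
      · simp
    constructor
    · rw [injective_iff_map_eq_zero]
      intro x hx
      funext i
      apply (l i).bijective_adjoint.1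
      ext z
      rw [← key, hx]; simp
    · intro f
      choose x hx using fun i => (l i).bijective_adjoint.2 (f.comp (AddMonoidHom.single G i))
      refine ⟨x, ?_⟩
      refine AddMonoidHom.functions_ext _ _ _ fun i z => ?_
      rw [key, hx]; rfl

theorem LinkingPairing.pi_form {ι : Type*} [Fintype ι] {G : ι → Type*}
    [∀ i, AddCommGroup (G i)] (l : ∀ i, LinkingPairing (G i)) (x y : ∀ i, G i) :
    (LinkingPairing.pi l).form x y = ∑ i, (l i).form (x i) (y i) := by
  simp [LinkingPairing.pi, AddMonoidHom.finsetSum_apply]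

theorem gaussSum_pi {ι : Type*} [Fintype ι] [DecidableEq ι] {G : ι → Type*}
    [∀ i, AddCommGroup (G i)] [∀ i, Fintype (G i)] (l : ∀ i, LinkingPairing (G i)) (k : ℕ+) :
    gaussSum (LinkingPairing.pi l) k = ∏ i, gaussSum (l i) k := by
  simp only [gaussSum, LinkingPairing.pi_form, phase_sum]
  exact (Fintype.prod_sum fun i x => phase k ((l i).form x x)).symm

open Matrix in
/-- The linking pairing on `(ℤ/N)^r` given by a symmetric invertible matrix. -/
def LinkingPairing.ofMatrix {r N : ℕ} [NeZero N] (A : Matrix (Fin r) (Fin r) (ZMod N))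
    (hA : A.IsSymm) (hdet : IsUnit A.det) : LinkingPairing (Fin r → ZMod N) where
  form := AddMonoidHom.mk' (fun x => AddMonoidHom.mk' (fun y => toQ N (x ⬝ᵥ A *ᵥ y))
      (fun y z => by rw [mulVec_add, dotProduct_add, map_add]))
    (fun x y => by ext z; simp [add_dotProduct, map_add])
  symm x y := by
    simp only [AddMonoidHom.mk'_apply]
    rw [dotProduct_mulVec, dotProduct_comm, ← mulVec_transpose, hA.eq]
  bijective_adjoint := by
    -- Pairing with the standard basis reads off the coordinates of `A x`; invertibility of `A` then
    -- gives both halves of bijectivity.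
    have key (x : Fin r → ZMod N) (i : Fin r) : x ⬝ᵥ A *ᵥ Pi.single i 1 = (A *ᵥ x) i := by
      rw [dotProduct_mulVec, dotProduct_single_one, ← mulVec_transpose, hA.eq]
    constructor
    · rw [injective_iff_map_eq_zero]
      intro x hx
      have h0 : A *ᵥ x = 0 := by
        funext i
        apply toQ_injective N
        rw [← key]
        simpa using DFunLike.congr_fun hx (Pi.single i 1)
      have := congrArg (A⁻¹ *ᵥ ·) h0
      simpa [Matrix.mulVec_mulVec, Matrix.nonsing_inv_mul A hdet] using this
    · intro f
      have ht (i : Fin r) : ∃ a, toQ N a = f (Pi.single i 1) := by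
        apply exists_toQ_eq
        rw [← map_nsmul, ← Pi.single_smul]
        simp
      choose a ha using ht
      refine ⟨A⁻¹ *ᵥ a, ?_⟩
      refine AddMonoidHom.functions_ext _ _ _ fun i z => ?_
      have hz : (Pi.single i z : Fin r → ZMod N) = z.val • Pi.single i 1 := by
        rw [← Pi.single_smul]; simp
      rw [hz, map_nsmul, map_nsmul, ← ha]
      congr 1
      simp only [AddMonoidHom.mk'_apply]
      rw [key, mulVec_mulVec, Matrix.mul_nonsing_inv A hdet, one_mulVec]

open Matrix in
theorem LinkingPairing.ofMatrix_form {r N : ℕ} [NeZero N] (A : Matrix (Fin r) (Fin r) (ZMod N))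
    (hA : A.IsSymm) (hdet : IsUnit A.det) (x y : Fin r → ZMod N) :
    (LinkingPairing.ofMatrix A hA hdet).form x y = toQ N (x ⬝ᵥ A *ᵥ y) := rfl

/-! ### Indecomposable blocks -/

/-- The kind of an elementary block: `odd j` is the rank one block with matrix `(2j+1)`, and
`even a c` is the rank two block with rows `(2a, 1)` and `(1, 2c)`. -/
inductive Kind where
  | odd (j : ℤ) : Kind
  | even (a c : ℤ) : Kind

/-- The rank of a block. -/
abbrev Kind.rank : Kind → ℕ
  | odd _ => 1
  | even _ _ => 2

/-- The integral Gram matrix of a block. -/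
def Kind.gram : (κ : Kind) → Matrix (Fin κ.rank) (Fin κ.rank) ℤ
  | odd j => !![2 * j + 1]
  | even a c => !![2 * a, 1; 1, 2 * c]

/-- The Gram matrix of a block, modulo `N`. -/
def Kind.gramMod (κ : Kind) (N : ℕ) : Matrix (Fin κ.rank) (Fin κ.rank) (ZMod N) :=
  κ.gram.map (Int.castRingHom (ZMod N))

theorem Kind.gram_isSymm (κ : Kind) : κ.gram.IsSymm := by
  cases κ with
  | odd j => ext i j; fin_cases i; fin_cases j; rfl
  | even a c => ext i j; fin_cases i <;> fin_cases j <;> rfl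

theorem Kind.gramMod_isSymm (κ : Kind) (N : ℕ) : (κ.gramMod N).IsSymm :=
  κ.gram_isSymm.map _

theorem isUnit_intCast_of_odd {z : ℤ} (hz : Odd z) (k : ℕ) : IsUnit (z : ZMod (2 ^ k)) := by
  have h : IsCoprime z ((2 ^ k : ℕ) : ℤ) := by
    push_cast
    obtain ⟨j, rfl⟩ := hz
    exact IsCoprime.pow_right ⟨1, -j, by ring⟩
  obtain ⟨a, b, hab⟩ := h
  refine IsUnit.of_mul_eq_one (a : ZMod (2 ^ k)) ?_
  have := congrArg (Int.cast : ℤ → ZMod (2 ^ k)) hab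
  have h2 : (((2 ^ k : ℕ) : ℤ) : ZMod (2 ^ k)) = 0 := by
    rw [Int.cast_natCast, ZMod.natCast_self]
  rw [Int.cast_add, Int.cast_mul, Int.cast_mul, h2, mul_zero, add_zero, Int.cast_one] at this
  rw [mul_comm]; exact this

/-- The integral determinant is `2j + 1` or `4ac - 1`, odd in either case. -/
theorem Kind.isUnit_det_gramMod (κ : Kind) (k : ℕ) : IsUnit (κ.gramMod (2 ^ k)).det := by
  have h : (κ.gramMod (2 ^ k)).det = ((κ.gram.det : ℤ) : ZMod (2 ^ k)) := by
    rw [gramMod, ← RingHom.mapMatrix_apply, ← RingHom.map_det]; rfl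
  rw [h]
  apply isUnit_intCast_of_odd
  cases κ with
  | odd j => simp [gram]
  | even a c =>
    rw [gram, Matrix.det_fin_two_of]
    exact ⟨2 * a * c - 1, by ring⟩

/-- An elementary block: a linking pairing of a given kind over `ℤ/2^k`. -/
structure Block where
  k : ℕ+
  kind : Kind

/-- The underlying group of a block. -/
abbrev Block.Carrier (b : Block) : Type := Fin b.kind.rank → ZMod (2 ^ (b.k : ℕ))

/-- The linking pairing of a block. -/
def Block.pairing (b : Block) : LinkingPairing b.Carrier :=
  LinkingPairing.ofMatrix (b.kind.gramMod _) (b.kind.gramMod_isSymm _)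
    (b.kind.isUnit_det_gramMod _)

/-! ### Quadratic Gauss sums modulo powers of two -/

/-- `e q = exp(2π√-1 q)`. -/
def e (q : ℚ) : ℂ := Complex.exp (2 * Real.pi * Complex.I * q)

theorem e_zero : e 0 = 1 := by simp [e]

theorem e_add (p q : ℚ) : e (p + q) = e p * e q := by
  rw [e, e, e, ← Complex.exp_add]; congr 1; push_cast; ring

theorem e_intCast (z : ℤ) : e z = 1 := by
  rw [e, Complex.exp_eq_one_iff]; exact ⟨z, by push_cast; ring⟩

theorem e_half : e (1 / 2) = -1 := by
  rw [e, ← Complex.exp_pi_mul_I]; congr 1; push_cast; ring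

theorem e_quarter : e (1 / 4) = Complex.I := by
  have h : (2 * Real.pi * Complex.I * ((1 / 4 : ℚ) : ℂ)) = Real.pi / 2 * Complex.I := by
    push_cast; ring
  rw [e, h, Complex.exp_pi_div_two_mul_I]

theorem e_eq_of_sub_int {p q : ℚ} (z : ℤ) (h : p = q + z) : e p = e q := by
  rw [h, e_add, e_intCast, mul_one]

theorem e_eq_neg_of_sub_half {p q : ℚ} (z : ℤ) (h : p = q + z + 1 / 2) : e p = -e q := by
  rw [h, e_add, e_add, e_intCast, e_half]; ring

theorem stdAddChar_intCast (z : ℤ) : ZMod.stdAddChar (z : ZMod 8) = e (z / 8) := by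
  rw [ZMod.stdAddChar_coe, e]; congr 1; push_cast; ring

theorem e_eighth : e (1 / 8) = (Real.sqrt 2 / 2 : ℝ) * (1 + Complex.I) := by
  have h : (2 * Real.pi * Complex.I * ((1 / 8 : ℚ) : ℂ)) = ((Real.pi / 4 : ℝ) : ℂ) * Complex.I := by
    push_cast; ring
  rw [e, h, Complex.exp_mul_I, ← Complex.ofReal_cos, ← Complex.ofReal_sin, Real.cos_pi_div_four,
    Real.sin_pi_div_four]
  ring

/-- Consecutive stretches of length `p` cancel in pairs. Each vanishing exponential sum below is an
instance. -/
theorem sum_range_mul_of_antiperiodic (p c : ℕ) (h : ℕ → ℂ) (hh : ∀ y, h (y + p) = -h y) :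
    ∑ y ∈ Finset.range (2 * p * c), h y = 0 := by
  induction c generalizing h with
  | zero => simp
  | succ c ih =>
    have h1 : 2 * p * (c + 1) = p + (p + 2 * p * c) := by ring
    rw [h1, Finset.sum_range_add, Finset.sum_range_add]
    have h2 : ∑ x ∈ Finset.range p, h (p + x) = -∑ x ∈ Finset.range p, h x := by
      rw [← Finset.sum_neg_distrib]
      exact Finset.sum_congr rfl fun x _ => by rw [add_comm, hh]
    have h3 := ih (fun x => h (p + (p + x))) fun y => by
      have : p + (p + (y + p)) = (p + (p + y)) + p := by ring
      simp only [this, hh]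
    rw [h2, h3]; ring

theorem sum_range_mul_of_periodic (p c : ℕ) (h : ℕ → ℂ) (hh : ∀ y, h (y + p) = h y) :
    ∑ y ∈ Finset.range (p * c), h y = c * ∑ y ∈ Finset.range p, h y := by
  induction c generalizing h with
  | zero => simp
  | succ c ih =>
    have h1 : p * (c + 1) = p + p * c := by ring
    rw [h1, Finset.sum_range_add]
    have h3 : ∑ x ∈ Finset.range (p * c), h (p + x) = ∑ x ∈ Finset.range (p * c), h x :=
      Finset.sum_congr rfl fun x _ => by rw [add_comm, hh]
    rw [h3, ih h hh]; push_cast; ring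

theorem sum_range_two_mul (N : ℕ) (f : ℕ → ℂ) :
    ∑ x ∈ Finset.range (2 * N), f x
      = ∑ y ∈ Finset.range N, f (2 * y) + ∑ y ∈ Finset.range N, f (2 * y + 1) := by
  induction N with
  | zero => simp
  | succ N ih =>
    have : 2 * (N + 1) = 2 * N + 1 + 1 := by ring
    rw [this, Finset.sum_range_succ, Finset.sum_range_succ, ih, Finset.sum_range_succ,
      Finset.sum_range_succ]
    ring

/-- `z` is a positive multiple of `exp(2π√-1 j / 8)`. -/
def HasPhase (z : ℂ) (j : ZMod 8) : Prop := ∃ c : ℝ, 0 < c ∧ z = c * ZMod.stdAddChar j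

theorem HasPhase.mul {z w : ℂ} {i j : ZMod 8} (hz : HasPhase z i) (hw : HasPhase w j) :
    HasPhase (z * w) (i + j) := by
  obtain ⟨c, hc, rfl⟩ := hz
  obtain ⟨d, hd, rfl⟩ := hw
  exact ⟨c * d, mul_pos hc hd, by rw [AddChar.map_add_eq_mul]; push_cast; ring⟩

theorem hasPhase_ofReal {c : ℝ} (hc : 0 < c) : HasPhase (c : ℂ) 0 :=
  ⟨c, hc, by simp⟩

theorem hasPhase_one : HasPhase 1 0 := by simpa using hasPhase_ofReal one_pos

theorem HasPhase.real_mul {z : ℂ} {j : ZMod 8} (hz : HasPhase z j) {c : ℝ} (hc : 0 < c) :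
    HasPhase (c * z) j := by
  simpa using (hasPhase_ofReal hc).mul hz

theorem HasPhase.prod {ι : Type*} (s : Finset ι) {z : ι → ℂ} {j : ι → ZMod 8}
    (h : ∀ i ∈ s, HasPhase (z i) (j i)) : HasPhase (∏ i ∈ s, z i) (∑ i ∈ s, j i) := by
  classical
  induction s using Finset.induction_on with
  | empty => simpa using hasPhase_one
  | insert a s ha ih =>
    rw [Finset.prod_insert ha, Finset.sum_insert ha]
    exact (h a (by simp)).mul (ih fun i hi => h i (by simp [hi]))

theorem HasPhase.ne_zero {z : ℂ} {j : ZMod 8} (h : HasPhase z j) : z ≠ 0 := by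
  obtain ⟨c, hc, rfl⟩ := h
  refine mul_ne_zero (by exact_mod_cast hc.ne') ?_
  intro h0
  have := AddChar.norm_apply (ZMod.stdAddChar (N := 8)) j
  rw [h0] at this; simp at this

theorem HasPhase.div_norm {z : ℂ} {j : ZMod 8} (h : HasPhase z j) :
    z / (‖z‖ : ℂ) = ZMod.stdAddChar j := by
  obtain ⟨c, hc, rfl⟩ := h
  rw [norm_mul, AddChar.norm_apply, mul_one, Complex.norm_real, Real.norm_of_nonneg hc.le]
  rw [mul_div_assoc, mul_comm, div_mul_cancel₀ _ (by exact_mod_cast hc.ne')]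

/-! ### Rank one Gauss sums -/

/-- The residue `±1` modulo `8` which is congruent to the odd integer `n` modulo `4`. -/
def unitSign (n : ℤ) : ZMod 8 := if n % 4 = 1 then 1 else -1

/-- The Gauss sum of the rank one form `n x² / 2^k`. -/
def oddSum (k m : ℕ) (n : ℤ) : ℂ :=
  ∑ x ∈ Finset.range (2 ^ k), e (n * (x : ℚ) ^ 2 * 2 ^ m / 2 ^ (k + 1))

theorem oddSum_of_lt {k m : ℕ} (h : k < m) (n : ℤ) : oddSum k m n = (2 ^ k : ℝ) := by
  obtain ⟨d, rfl⟩ := Nat.exists_eq_add_of_lt h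
  have : ∀ x ∈ Finset.range (2 ^ k),
      e (n * (x : ℚ) ^ 2 * 2 ^ (k + d + 1) / 2 ^ (k + 1)) = 1 := fun x _ => by
    rw [← e_intCast (n * x ^ 2 * 2 ^ d)]
    congr 1; push_cast; field_simp; ring
  rw [oddSum, Finset.sum_congr rfl this]; simp

/-- The exponent is `n x² / 2` with `n` odd, so the terms alternate in sign. -/
theorem oddSum_self {k : ℕ} (hk : 0 < k) {n : ℤ} (hn : Odd n) : oddSum k k n = 0 := by
  obtain ⟨k, rfl⟩ := Nat.exists_eq_succ_of_ne_zero hk.ne'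
  have h2 : 2 ^ (k.succ) = 2 * 1 * 2 ^ k := by rw [Nat.succ_eq_add_one]; ring
  obtain ⟨j, rfl⟩ := hn
  rw [oddSum, h2]
  refine sum_range_mul_of_antiperiodic _ _ _ fun y => ?_
  refine e_eq_neg_of_sub_half ((2 * j + 1) * y + j) ?_
  push_cast; field_simp; ring

/-- The exponent is `n x² / 4`, which modulo 1 depends only on `x` modulo 4. One period sums to `2 +
2 i^n`, that is `2√2 exp(±πi/4)` with the sign of `unitSign n`. -/
theorem oddSum_succ {m : ℕ} (hm : 0 < m) {n : ℤ} (hn : Odd n) :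
    HasPhase (oddSum (m + 1) m n) (unitSign n) := by
  obtain ⟨m, rfl⟩ := Nat.exists_eq_succ_of_ne_zero hm.ne'
  have h2 : 2 ^ (m.succ + 1) = 4 * 2 ^ m := by rw [Nat.succ_eq_add_one]; ring
  rw [oddSum, h2, sum_range_mul_of_periodic]
  · have hc : (((2 ^ m : ℕ)) : ℂ) = ((2 ^ m : ℝ) : ℂ) := by push_cast; rfl
    rw [hc]
    refine HasPhase.real_mul ?_ (by positivity)
    have hv (x : ℕ) : e (n * (x : ℚ) ^ 2 * 2 ^ m.succ / 2 ^ (m.succ + 1 + 1))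
        = e (n * (x : ℚ) ^ 2 / 4) := by congr 1; rw [Nat.succ_eq_add_one]; field_simp; ring
    simp only [hv, Finset.sum_range_succ, Finset.sum_range_zero]
    have hs : (Real.sqrt 2 : ℂ) * Real.sqrt 2 = 2 := by
      rw [← Complex.ofReal_mul, Real.mul_self_sqrt (by norm_num)]; norm_num
    have hpos : 0 < 2 * Real.sqrt 2 := by positivity
    have h4 : n % 4 = 1 ∨ n % 4 = 3 := by have := Int.odd_iff.mp hn; omega
    refine ⟨_, hpos, ?_⟩
    rcases h4 with h4 | h4
    · obtain ⟨q, rfl⟩ : ∃ q, n = 4 * q + 1 := ⟨n / 4, by omega⟩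
      rw [unitSign, if_pos h4]
      have h1 : ZMod.stdAddChar (1 : ZMod 8) = e (1 / 8) := by
        simpa using stdAddChar_intCast 1
      rw [h1, e_eighth]
      rw [e_eq_of_sub_int (p := ((4 * q + 1 : ℤ) : ℚ) * ((0 : ℕ) : ℚ) ^ 2 / 4) (q := 0) 0
          (by push_cast; ring),
        e_eq_of_sub_int (p := ((4 * q + 1 : ℤ) : ℚ) * ((1 : ℕ) : ℚ) ^ 2 / 4) (q := 1 / 4) q
          (by push_cast; ring),
        e_eq_of_sub_int (p := ((4 * q + 1 : ℤ) : ℚ) * ((2 : ℕ) : ℚ) ^ 2 / 4) (q := 0) (4 * q + 1)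
          (by push_cast; ring),
        e_eq_of_sub_int (p := ((4 * q + 1 : ℤ) : ℚ) * ((3 : ℕ) : ℚ) ^ 2 / 4) (q := 1 / 4) (9 * q + 2)
          (by push_cast; ring), e_zero, e_quarter]
      push_cast
      linear_combination (-(1 + Complex.I)) * hs
    · obtain ⟨q, rfl⟩ : ∃ q, n = 4 * q + 3 := ⟨n / 4, by omega⟩
      rw [unitSign, if_neg (by omega)]
      have h1 : ZMod.stdAddChar (-1 : ZMod 8) = e (-1 / 8) := by
        simpa using stdAddChar_intCast (-1)
      -- `-1/8 = 1/8 + 1/4 + 1/2 - 1` reduces to the values of `e` already computed.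
      have h3 : e (-1 / 8) = e (1 / 8) * e (1 / 4) * e (1 / 2) := by
        rw [← e_add, ← e_add]
        exact e_eq_of_sub_int (-1) (by norm_num)
      have h5 : e (3 / 4) = -Complex.I := by
        rw [e_eq_neg_of_sub_half (q := 1 / 4) 0 (by norm_num), e_quarter]
      rw [h1, h3, e_eighth, e_half, e_quarter]
      rw [e_eq_of_sub_int (p := ((4 * q + 3 : ℤ) : ℚ) * ((0 : ℕ) : ℚ) ^ 2 / 4) (q := 0) 0
          (by push_cast; ring),
        e_eq_of_sub_int (p := ((4 * q + 3 : ℤ) : ℚ) * ((1 : ℕ) : ℚ) ^ 2 / 4) (q := 3 / 4) q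
          (by push_cast; ring),
        e_eq_of_sub_int (p := ((4 * q + 3 : ℤ) : ℚ) * ((2 : ℕ) : ℚ) ^ 2 / 4) (q := 0) (4 * q + 3)
          (by push_cast; ring),
        e_eq_of_sub_int (p := ((4 * q + 3 : ℤ) : ℚ) * ((3 : ℕ) : ℚ) ^ 2 / 4) (q := 3 / 4) (9 * q + 6)
          (by push_cast; ring), e_zero, h5]
      push_cast
      linear_combination (Complex.I * (1 + Complex.I)) * hs + 2 * Complex.I_sq
  · intro y
    refine e_eq_of_sub_int (n * (2 * y + 4)) ?_
    rw [Nat.succ_eq_add_one]; push_cast; field_simp; ring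

/-- The exponent is `n x² / 8`. Over one period of length 8 the even `x` give `1, -1, 1, -1` and
cancel, while each odd square is `1` modulo 8, leaving `4 exp(2πi n/8)`. -/
theorem oddSum_succ_succ {m : ℕ} (hm : 0 < m) {n : ℤ} (hn : Odd n) :
    HasPhase (oddSum (m + 2) m n) (n : ZMod 8) := by
  obtain ⟨m, rfl⟩ := Nat.exists_eq_succ_of_ne_zero hm.ne'
  have h2 : 2 ^ (m.succ + 2) = 8 * 2 ^ m := by rw [Nat.succ_eq_add_one]; ring
  rw [oddSum, h2, sum_range_mul_of_periodic]
  · have hc : (((2 ^ m : ℕ)) : ℂ) = ((2 ^ m : ℝ) : ℂ) := by push_cast; rfl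
    rw [hc]
    refine HasPhase.real_mul ?_ (by positivity)
    have hv (x : ℕ) : e (n * (x : ℚ) ^ 2 * 2 ^ m.succ / 2 ^ (m.succ + 2 + 1))
        = e (n * (x : ℚ) ^ 2 / 8) := by congr 1; rw [Nat.succ_eq_add_one]; field_simp; ring
    simp only [hv, Finset.sum_range_succ, Finset.sum_range_zero]
    obtain ⟨j, rfl⟩ := hn
    refine ⟨4, by norm_num, ?_⟩
    rw [stdAddChar_intCast]
    set n : ℤ := 2 * j + 1 with hnj
    have hnq : (n : ℚ) = 2 * j + 1 := by rw [hnj]; push_cast; ring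
    rw [e_eq_of_sub_int (p := n * ((0 : ℕ) : ℚ) ^ 2 / 8) (q := 0) 0 (by push_cast; ring),
      e_eq_of_sub_int (p := n * ((1 : ℕ) : ℚ) ^ 2 / 8) (q := n / 8) 0 (by push_cast; ring),
      e_eq_neg_of_sub_half (p := n * ((2 : ℕ) : ℚ) ^ 2 / 8) (q := 0) j
        (by rw [hnq]; push_cast; ring),
      e_eq_of_sub_int (p := n * ((3 : ℕ) : ℚ) ^ 2 / 8) (q := n / 8) n (by push_cast; ring),
      e_eq_of_sub_int (p := n * ((4 : ℕ) : ℚ) ^ 2 / 8) (q := 0) (2 * n) (by push_cast; ring),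
      e_eq_of_sub_int (p := n * ((5 : ℕ) : ℚ) ^ 2 / 8) (q := n / 8) (3 * n) (by push_cast; ring),
      e_eq_neg_of_sub_half (p := n * ((6 : ℕ) : ℚ) ^ 2 / 8) (q := 0) (4 * n + j)
        (by push_cast; rw [hnq]; ring),
      e_eq_of_sub_int (p := n * ((7 : ℕ) : ℚ) ^ 2 / 8) (q := n / 8) (6 * n) (by push_cast; ring),
      e_zero]
    push_cast; ring
  · intro y
    refine e_eq_of_sub_int (n * (2 * y + 8)) ?_
    rw [Nat.succ_eq_add_one]; push_cast; field_simp; ring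

/-- Odd `x` cancel, because replacing `x` by `x + 2^(d+2)` changes the sign; for even `x` the square
supplies a factor 4. The distance `k - m` drops by two. -/
theorem oddSum_reduce (m d : ℕ) {n : ℤ} (hn : Odd n) :
    oddSum (m + d + 3) m n = oddSum (m + d + 2) (m + 1) n := by
  rw [oddSum, show 2 ^ (m + d + 3) = 2 * 2 ^ (m + d + 2) by ring, sum_range_two_mul]
  have h0 : ∑ y ∈ Finset.range (2 ^ (m + d + 2)),
      e (n * ((2 * y + 1 : ℕ) : ℚ) ^ 2 * 2 ^ m / 2 ^ (m + d + 3 + 1)) = 0 := by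
    rw [show 2 ^ (m + d + 2) = 2 * 2 ^ (d + 1) * 2 ^ m by ring]
    refine sum_range_mul_of_antiperiodic _ _ _ fun y => ?_
    obtain ⟨j, rfl⟩ := hn
    refine e_eq_neg_of_sub_half ((2 * j + 1) * y + j + (2 * j + 1) * 2 ^ d) ?_
    push_cast; field_simp; ring
  rw [h0, add_zero, oddSum]
  refine Finset.sum_congr rfl fun x _ => ?_
  congr 1
  push_cast; field_simp; ring

/-- `oddSum_reduce` preserves the parity of the distance `k - m`, so only the distances 1 and 2 need
evaluation. -/
theorem oddSum_hasPhase (d : ℕ) {m : ℕ} (hm : 0 < m) {n : ℤ} (hn : Odd n) :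
    HasPhase (oddSum (m + (d + 1)) m n) (if Odd (d + 1) then unitSign n else (n : ZMod 8)) := by
  induction d using Nat.twoStepInduction generalizing m with
  | zero => simpa using oddSum_succ hm hn
  | one => simpa [show ¬ Odd 2 by decide] using oddSum_succ_succ hm hn
  | more d ih _ =>
    have h := ih (m := m + 1) (by omega)
    rw [show m + (d + 2 + 1) = m + d + 3 by ring, oddSum_reduce m d hn,
      show m + d + 2 = m + 1 + (d + 1) by ring]
    have : Odd (d + 2 + 1) ↔ Odd (d + 1) := by
      rw [Nat.odd_iff, Nat.odd_iff]; omega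
    simpa only [this] using h

/-! ### Rank two Gauss sums -/

/-- The Gauss sum of the rank two form `2 (a x² + x y + c y²) / 2^k`. -/
def evenSum (k m : ℕ) (a c : ℤ) : ℂ :=
  ∑ x ∈ Finset.range (2 ^ k), ∑ y ∈ Finset.range (2 ^ k),
    e ((a * (x : ℚ) ^ 2 + x * y + c * (y : ℚ) ^ 2) * 2 ^ m / 2 ^ k)

theorem evenSum_of_le {k m : ℕ} (h : k ≤ m) (a c : ℤ) :
    evenSum k m a c = (2 ^ k * 2 ^ k : ℝ) := by
  obtain ⟨d, rfl⟩ := Nat.exists_eq_add_of_le h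
  have (x y : ℕ) :
      e ((a * (x : ℚ) ^ 2 + x * y + c * (y : ℚ) ^ 2) * 2 ^ (k + d) / 2 ^ k) = 1 := by
    rw [← e_intCast ((a * x ^ 2 + x * y + c * y ^ 2) * 2 ^ d)]
    congr 1; push_cast; field_simp; ring
  simp [evenSum, this]

/-- Up to a positive factor this is the sum of `(-1)^q` over `𝔽₂²` for `q = ax² + xy + cy²`. It
equals `2` or `-2` according to the Arf invariant of `q`, which is `ac`. -/
theorem evenSum_succ (m : ℕ) (a c : ℤ) :
    HasPhase (evenSum (m + 1) m a c) (if Odd a ∧ Odd c then 4 else 0) := by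
  have hv (x y : ℕ) : e ((a * (x : ℚ) ^ 2 + x * y + c * (y : ℚ) ^ 2) * 2 ^ m / 2 ^ (m + 1))
      = e ((a * (x : ℚ) ^ 2 + x * y + c * (y : ℚ) ^ 2) / 2) := by
    congr 1; field_simp; ring
  have hy (x : ℕ) : ∑ y ∈ Finset.range (2 ^ (m + 1)),
      e ((a * (x : ℚ) ^ 2 + x * y + c * (y : ℚ) ^ 2) / 2)
      = (2 ^ m : ℝ) * ∑ y ∈ Finset.range 2,
        e ((a * (x : ℚ) ^ 2 + x * y + c * (y : ℚ) ^ 2) / 2) := by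
    rw [show 2 ^ (m + 1) = 2 * 2 ^ m by ring, sum_range_mul_of_periodic]
    · push_cast; rfl
    · intro y
      refine e_eq_of_sub_int (x + 2 * c * y + 2 * c) ?_
      push_cast; ring
  simp only [evenSum, hv, hy]
  rw [← Finset.mul_sum]
  refine HasPhase.real_mul ?_ (by positivity)
  rw [show 2 ^ (m + 1) = 2 * 2 ^ m by ring, sum_range_mul_of_periodic]
  · have hc : (((2 ^ m : ℕ)) : ℂ) = ((2 ^ m : ℝ) : ℂ) := by push_cast; rfl
    rw [hc]
    refine HasPhase.real_mul ?_ (by positivity)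
    simp only [Finset.sum_range_succ, Finset.sum_range_zero]
    have h4 : ZMod.stdAddChar (4 : ZMod 8) = -1 := by
      have := stdAddChar_intCast 4
      push_cast at this
      rw [this, ← e_half]; norm_num
    have hint (z : ℤ) : e (z / 2) = if Odd z then -1 else 1 := by
      split_ifs with h
      · obtain ⟨j, rfl⟩ := h
        rw [e_eq_neg_of_sub_half (q := 0) j (by push_cast; ring), e_zero]
      · obtain ⟨j, rfl⟩ := Int.not_odd_iff_even.mp h
        rw [e_eq_of_sub_int (q := 0) j (by push_cast; ring), e_zero]
    have h00 : e ((a * ((0 : ℕ) : ℚ) ^ 2 + ((0 : ℕ) : ℚ) * ((0 : ℕ) : ℚ)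
        + c * ((0 : ℕ) : ℚ) ^ 2) / 2) = 1 := by rw [← e_zero]; congr 1; simp
    have h01 : e ((a * ((0 : ℕ) : ℚ) ^ 2 + ((0 : ℕ) : ℚ) * ((1 : ℕ) : ℚ)
        + c * ((1 : ℕ) : ℚ) ^ 2) / 2) = if Odd c then -1 else 1 := by
      rw [← hint]; congr 1; push_cast; ring
    have h10 : e ((a * ((1 : ℕ) : ℚ) ^ 2 + ((1 : ℕ) : ℚ) * ((0 : ℕ) : ℚ)
        + c * ((0 : ℕ) : ℚ) ^ 2) / 2) = if Odd a then -1 else 1 := by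
      rw [← hint]; congr 1; push_cast; ring
    have h11 : e ((a * ((1 : ℕ) : ℚ) ^ 2 + ((1 : ℕ) : ℚ) * ((1 : ℕ) : ℚ)
        + c * ((1 : ℕ) : ℚ) ^ 2) / 2) = if Odd (a + 1 + c) then -1 else 1 := by
      rw [← hint]; congr 1; push_cast; ring
    rw [h00, h01, h10, h11]
    refine ⟨2, by norm_num, ?_⟩
    have hac : Odd (a + 1 + c) ↔ (Odd a ↔ Odd c) := by
      simp only [Int.odd_iff]; omega
    simp only [hac]
    by_cases ha : Odd a <;> by_cases hc : Odd c <;> simp [ha, hc, h4] <;> norm_num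
  · intro x
    refine Finset.sum_congr rfl fun y _ => ?_
    refine e_eq_of_sub_int (y + 2 * a * x + 2 * a) ?_
    push_cast; ring

/-- For `x` odd the cross term makes the sum over `y` antiperiodic; then for `x` even and `y` odd
the sum over `x` is antiperiodic. The terms with both even carry a factor 4. -/
theorem evenSum_reduce (m d : ℕ) (a c : ℤ) :
    evenSum (m + d + 2) m a c = evenSum (m + d + 1) (m + 1) a c := by
  have hp : 2 ^ (m + d + 2) = 2 * 2 ^ (m + d + 1) := by ring
  rw [evenSum, hp, sum_range_two_mul]
  have h0 : ∑ x ∈ Finset.range (2 ^ (m + d + 1)), ∑ y ∈ Finset.range (2 * 2 ^ (m + d + 1)),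
      e ((a * ((2 * x + 1 : ℕ) : ℚ) ^ 2 + ((2 * x + 1 : ℕ) : ℚ) * y + c * (y : ℚ) ^ 2) * 2 ^ m
        / 2 ^ (m + d + 2)) = 0 := by
    refine Finset.sum_eq_zero fun x _ => ?_
    rw [show 2 * 2 ^ (m + d + 1) = 2 * 2 ^ (d + 1) * 2 ^ m by ring]
    refine sum_range_mul_of_antiperiodic _ _ _ fun y => ?_
    refine e_eq_neg_of_sub_half (x + c * y + c * 2 ^ d) ?_
    push_cast; field_simp; ring
  have h1 : ∑ x ∈ Finset.range (2 ^ (m + d + 1)), ∑ y ∈ Finset.range (2 ^ (m + d + 1)),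
      e ((a * ((2 * x : ℕ) : ℚ) ^ 2 + ((2 * x : ℕ) : ℚ) * ((2 * y + 1 : ℕ) : ℚ)
        + c * ((2 * y + 1 : ℕ) : ℚ) ^ 2) * 2 ^ m / 2 ^ (m + d + 2)) = 0 := by
    rw [Finset.sum_comm]
    refine Finset.sum_eq_zero fun y _ => ?_
    rw [show 2 ^ (m + d + 1) = 2 * 2 ^ d * 2 ^ m by ring]
    refine sum_range_mul_of_antiperiodic _ _ _ fun x => ?_
    refine e_eq_neg_of_sub_half (y + 2 * a * x + a * 2 ^ d) ?_
    push_cast; field_simp; ring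
  rw [h0, add_zero]
  simp only [sum_range_two_mul]
  rw [Finset.sum_add_distrib, h1, add_zero, evenSum]
  refine Finset.sum_congr rfl fun x _ => Finset.sum_congr rfl fun y _ => ?_
  congr 1
  push_cast; field_simp; ring

theorem evenSum_hasPhase (d m : ℕ) (a c : ℤ) :
    HasPhase (evenSum (m + d) m a c) (if Odd d ∧ Odd a ∧ Odd c then 4 else 0) := by
  induction d using Nat.twoStepInduction generalizing m with
  | zero =>
    rw [evenSum_of_le (by omega)]
    simpa using hasPhase_ofReal (c := 2 ^ m * 2 ^ m) (by positivity)
  | one => simpa using evenSum_succ m a c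
  | more d ih _ =>
    have h := ih (m + 1)
    rw [show m + (d + 2) = m + d + 2 by ring, evenSum_reduce m d,
      show m + d + 1 = m + 1 + d by ring]
    have : Odd (d + 2) ↔ Odd d := by rw [Nat.odd_iff, Nat.odd_iff]; omega
    simpa only [this] using h

/-! ### Gauss sums of blocks -/

theorem sum_zmod_eq_sum_range (N : ℕ) [NeZero N] (f : ZMod N → ℂ) :
    ∑ x : ZMod N, f x = ∑ x ∈ Finset.range N, f ((x : ℤ) : ZMod N) := by
  refine Finset.sum_bij' (fun x _ => x.val) (fun x _ => (x : ZMod N)) ?_ ?_ ?_ ?_ ?_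
  · intro x _; simpa using ZMod.val_lt x
  · simp
  · intro x _; simp
  · intro x hx; exact ZMod.val_cast_of_lt (by simpa using hx)
  · intro x _; simp

theorem phase_toQ (m : ℕ+) (N : ℕ) [NeZero N] (z : ℤ) :
    phase m (toQ N (z : ZMod N)) = e (z * 2 ^ (m : ℕ) / (2 * N)) := by
  rw [toQ_intCast, phase_coe, e]
  congr 1
  push_cast
  have hN : (N : ℂ) ≠ 0 := Nat.cast_ne_zero.mpr (NeZero.ne N)
  field_simp

/-- Whether a block is of odd kind. -/
def Kind.IsOdd : Kind → Prop
  | odd _ => True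
  | even _ _ => False

/-- The contribution of a block over `ℤ/2^k` to `σ_m` if `k - m` is positive and odd. -/
def Kind.u : Kind → ZMod 8
  | odd j => unitSign (2 * j + 1)
  | even a c => open Classical in if Odd a ∧ Odd c then 4 else 0

/-- The contribution of a block over `ℤ/2^k` to `σ_m` if `k - m` is positive and even. -/
def Kind.v : Kind → ZMod 8
  | odd j => ((2 * j + 1 : ℤ) : ZMod 8)
  | even _ _ => 0

/-- The contribution of a block to `σ_m`, if finite. -/
def Block.sig (b : Block) (m : ℕ+) : ZMod 8 :=
  if b.k ≤ m then 0 else if Odd ((b.k : ℕ) - m) then b.kind.u else b.kind.v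

theorem gaussSum_odd (k m : ℕ+) (j : ℤ) :
    gaussSum (Block.pairing ⟨k, .odd j⟩) m = oddSum k m (2 * j + 1) := by
  have h1 : gaussSum (Block.pairing ⟨k, .odd j⟩) m
      = ∑ x : ZMod (2 ^ (k : ℕ)), phase m (toQ _ (((2 * j + 1 : ℤ) : ZMod _) * x ^ 2)) := by
    refine Fintype.sum_equiv (Equiv.funUnique (Fin 1) (ZMod (2 ^ (k : ℕ)))) _ _ fun x => ?_
    rw [Block.pairing, LinkingPairing.ofMatrix_form]
    congr 2
    simp [Matrix.mulVec, dotProduct, Kind.gramMod, Kind.gram, Kind.rank]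
    ring
  rw [h1, sum_zmod_eq_sum_range, oddSum]
  refine Finset.sum_congr rfl fun x _ => ?_
  rw [← Int.cast_pow, ← Int.cast_mul, phase_toQ]
  congr 1
  push_cast
  rw [pow_succ]
  ring

theorem gaussSum_even (k m : ℕ+) (a c : ℤ) :
    gaussSum (Block.pairing ⟨k, .even a c⟩) m = evenSum k m a c := by
  have h1 : gaussSum (Block.pairing ⟨k, .even a c⟩) m
      = ∑ p : ZMod (2 ^ (k : ℕ)) × ZMod (2 ^ (k : ℕ)),
        phase m (toQ _ (((2 : ℤ) : ZMod _) * ((a : ZMod _) * p.1 ^ 2 + p.1 * p.2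
          + (c : ZMod _) * p.2 ^ 2))) := by
    refine Fintype.sum_equiv (finTwoArrowEquiv (ZMod (2 ^ (k : ℕ)))) _ _ fun x => ?_
    rw [Block.pairing, LinkingPairing.ofMatrix_form]
    congr 2
    simp [Matrix.mulVec, dotProduct, Kind.gramMod, Kind.gram, Kind.rank, Fin.sum_univ_two]
    ring
  rw [h1, Fintype.sum_prod_type, sum_zmod_eq_sum_range, evenSum]
  refine Finset.sum_congr rfl fun x _ => ?_
  rw [sum_zmod_eq_sum_range]
  refine Finset.sum_congr rfl fun y _ => ?_
  simp only [← Int.cast_pow, ← Int.cast_mul, ← Int.cast_add]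
  rw [phase_toQ]
  congr 1
  push_cast
  ring

theorem Block.gaussSum_eq_zero (b : Block) (h : b.kind.IsOdd) : gaussSum b.pairing b.k = 0 := by
  obtain ⟨k, κ⟩ := b
  cases κ with
  | odd j => exact (gaussSum_odd k k j).trans (oddSum_self k.pos ⟨j, rfl⟩)
  | even a c => exact h.elim

/-- With `Block.gaussSum_eq_zero` this settles every pair `(b, m)`: the sum vanishes only for an odd
block at `m`. -/
theorem Block.gaussSum_hasPhase (b : Block) (m : ℕ+) (h : ¬ (b.k = m ∧ b.kind.IsOdd)) :
    HasPhase (gaussSum b.pairing m) (b.sig m) := by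
  obtain ⟨k, κ⟩ := b
  cases κ with
  | odd j =>
    rw [gaussSum_odd]
    have hne : k ≠ m := fun h' => h ⟨h', trivial⟩
    rcases lt_or_gt_of_ne hne with hlt | hgt
    · have h0 : (⟨k, .odd j⟩ : Block).sig m = 0 := if_pos hlt.le
      rw [h0, oddSum_of_lt (by exact_mod_cast hlt)]
      exact hasPhase_ofReal (by positivity)
    · obtain ⟨d, hd⟩ := Nat.exists_eq_add_of_lt (show (m : ℕ) < k by exact_mod_cast hgt)
      have h0 : (⟨k, .odd j⟩ : Block).sig m = if Odd (d + 1) then unitSign (2 * j + 1)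
          else ((2 * j + 1 : ℤ) : ZMod 8) := by
        rw [Block.sig, if_neg (not_le.mpr hgt)]
        have : (k : ℕ) - m = d + 1 := by omega
        simp only [this]; rfl
      rw [h0, hd]
      exact oddSum_hasPhase d m.pos ⟨j, rfl⟩
  | even a c =>
    rw [gaussSum_even]
    rcases le_or_gt k m with hle | hgt
    · have h0 : (⟨k, .even a c⟩ : Block).sig m = 0 := if_pos hle
      rw [h0, evenSum_of_le (by exact_mod_cast hle)]
      exact hasPhase_ofReal (by positivity)
    · obtain ⟨d, hd⟩ := Nat.exists_eq_add_of_lt (show (m : ℕ) < k by exact_mod_cast hgt)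
      have h0 : (⟨k, .even a c⟩ : Block).sig m
          = if Odd (d + 1) ∧ Odd a ∧ Odd c then 4 else 0 := by
        rw [Block.sig, if_neg (not_le.mpr hgt)]
        have : (k : ℕ) - m = d + 1 := by omega
        simp only [this, Kind.u, Kind.v, ite_and]
      rw [h0, hd]
      exact evenSum_hasPhase (d + 1) m a c

open Classical in
/-- The signature at `m` of an orthogonal sum of blocks. -/
def familySig {ι : Type} [Fintype ι] (B : ι → Block) (m : ℕ+) : Z8bar :=
  if ∃ i, (B i).k = m ∧ (B i).kind.IsOdd then ⊤ else ((∑ i, (B i).sig m : ZMod 8) : Z8bar)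

open Classical in
/-- The rank at `m` of an orthogonal sum of blocks. -/
def familyRank {ι : Type} [Fintype ι] (B : ι → Block) (m : ℕ+) : ℕ :=
  ∑ i, if (B i).k = m then (B i).kind.rank else 0

/-- A linking pairing is isometric to the orthogonal sum of a family of blocks. -/
def IsSumOfBlocks {G : Type} [AddCommGroup G] (l : LinkingPairing G) {ι : Type} [Fintype ι]
    (B : ι → Block) : Prop :=
  ∃ f : G ≃+ (∀ i, (B i).Carrier), ∀ x y,
    l.form x y = (LinkingPairing.pi fun i => (B i).pairing).form (f x) (f y)

/-- The Gauss sum is a product over the blocks, so a single vanishing factor gives `∞`, and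
otherwise the phases add. -/
theorem IsSumOfBlocks.sigma_eq {G : Type} [AddCommGroup G] [Fintype G] {l : LinkingPairing G}
    {ι : Type} [Fintype ι] {B : ι → Block} (h : IsSumOfBlocks l B) (m : ℕ+) :
    sigma l m = familySig B m := by
  classical
  obtain ⟨f, hf⟩ := h
  have hg : gaussSum l m = ∏ i, gaussSum (B i).pairing m := by
    rw [gaussSum_congr l _ f hf, gaussSum_pi]
  rw [familySig]
  split_ifs with hodd
  · obtain ⟨i, rfl, hi⟩ := hodd
    rw [sigma, if_pos]
    rw [hg]
    exact Finset.prod_eq_zero (Finset.mem_univ i) ((B i).gaussSum_eq_zero hi)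
  · push Not at hodd
    have hp : HasPhase (gaussSum l m) (∑ i, (B i).sig m) := by
      rw [hg]
      exact HasPhase.prod _ fun i _ => (B i).gaussSum_hasPhase m fun h => hodd i h.1 h.2
    exact sigma_eq_coe l m _ hp.ne_zero hp.div_norm

/-! ### Decomposition of linking pairings into blocks -/

/-- A nondegenerate piece with an orthogonal projection `p` splits off. An element of `ker p` pairs
with `g` as it does with the component of `g` in `ker p`, so the restriction to `ker p` is again
nondegenerate. -/
theorem exists_orthogonal_complement {G A : Type*} [AddCommGroup G] [AddCommGroup A]
    (l : LinkingPairing G) (lA : LinkingPairing A) (φ : A →+ G) (p : G →+ A)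
    (hp : ∀ a, p (φ a) = a) (hl : ∀ a b, l.form (φ a) (φ b) = lA.form a b)
    (horth : ∀ g a, p g = 0 → l.form g (φ a) = 0) :
    ∃ (lK : LinkingPairing p.ker) (f : G ≃+ A × p.ker), ∀ x y,
      l.form x y = lA.form (f x).1 (f y).1 + lK.form (f x).2 (f y).2 := by
  have horth' (g : G) (a : A) (h : p g = 0) : l.form (φ a) g = 0 := by
    rw [l.symm]; exact horth g a h
  have hker (g : G) : g - φ (p g) ∈ p.ker := by
    rw [AddMonoidHom.mem_ker, map_sub, hp, sub_self]
  let π : G →+ p.ker := AddMonoidHom.mk' (fun g => ⟨g - φ (p g), hker g⟩) fun a b => by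
    ext; simp only [map_add, AddSubgroup.coe_add]; abel
  have hπ (g : G) : ((π g : p.ker) : G) = g - φ (p g) := rfl
  have hπ' (g : p.ker) : π g = g := by
    ext; rw [hπ, AddMonoidHom.mem_ker.mp g.2, map_zero, sub_zero]
  have hrestr (g : G) (y : p.ker) : l.form (π g : p.ker) y = l.form g y := by
    rw [hπ, map_sub, AddMonoidHom.sub_apply, horth' _ _ (AddMonoidHom.mem_ker.mp y.2), sub_zero]
  let lK : LinkingPairing p.ker :=
    { form := (l.form.compl₂ p.ker.subtype).comp p.ker.subtype
      symm := fun x y => l.symm _ _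
      bijective_adjoint := by
        constructor
        · rw [injective_iff_map_eq_zero]
          intro x hx
          have h0 : l.form (x : G) = 0 := by
            ext g
            have h1 : l.form (x : G) (π g : p.ker) = 0 := DFunLike.congr_fun hx (π g)
            rw [hπ, map_sub, horth _ _ (AddMonoidHom.mem_ker.mp x.2), sub_zero] at h1
            simpa using h1
          ext
          exact l.bijective_adjoint.1 (by rw [h0]; simp)
        · intro f
          obtain ⟨g, hg⟩ := l.bijective_adjoint.2 (f.comp π)
          refine ⟨π g, ?_⟩
          ext y
          change l.form (π g : p.ker) (y : G) = f y
          rw [hrestr, hg]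
          simp [hπ'] }
  let f : G ≃+ A × p.ker := AddEquiv.mk'
    ⟨fun g => (p g, π g), fun q => φ q.1 + q.2, fun g => by simp [hπ], fun ⟨a, y⟩ => by
      have hy := AddMonoidHom.mem_ker.mp y.2
      refine Prod.ext ?_ ?_
      · simp [hp, hy]
      · ext; rw [hπ]; simp [hp, hy]⟩ fun a b => by simp
  refine ⟨lK, f, ?_⟩
  · intro x y
    change l.form x y = lA.form (p x) (p y) + l.form (π x : p.ker) (π y : p.ker)
    rw [hrestr, hπ, map_sub, ← hl]
    have h1 : l.form x (φ (p y)) = l.form (φ (p x)) (φ (p y)) := by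
      have := horth _ (p y) (AddMonoidHom.mem_ker.mp (hker x))
      rw [map_sub, AddMonoidHom.sub_apply, sub_eq_zero] at this
      exact this
    rw [h1]; abel

/-- The homomorphism `ℤ/N → G` with `1 ↦ g`. -/
def zmodHom {G : Type*} [AddCommGroup G] (N : ℕ) (g : G) (hg : N • g = 0) : ZMod N →+ G :=
  ZMod.lift N ⟨zmultiplesHom G g, by simpa using hg⟩

theorem zmodHom_apply {G : Type*} [AddCommGroup G] (N : ℕ) [NeZero N] (g : G) (hg : N • g = 0)
    (a : ZMod N) : zmodHom N g hg a = a.val • g := by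
  have h : a = ((a.val : ℤ) : ZMod N) := by simp
  conv_lhs => rw [h]
  rw [zmodHom, ZMod.lift_coe, zmultiplesHom_apply, natCast_zsmul]

-- Vectors whose Gram matrix is that of a block span an orthogonal summand: since the Gram matrix is
-- invertible over `ℤ/2^k` and `2^k` kills `G`, orthogonal projection to their span exists.
open Matrix in
theorem exists_split_block {G : Type*} [AddCommGroup G] (l : LinkingPairing G) (b : Block)
    (hk : ∀ g : G, 2 ^ (b.k : ℕ) • g = 0) (x : Fin b.kind.rank → G)
    (hx : ∀ i j, l.form (x i) (x j) = toQ _ (b.kind.gramMod (2 ^ (b.k : ℕ)) i j)) :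
    ∃ (K : AddSubgroup G) (lK : LinkingPairing K) (f : G ≃+ b.Carrier × K), ∀ x y,
      l.form x y = b.pairing.form (f x).1 (f y).1 + lK.form (f x).2 (f y).2 := by
  set N := 2 ^ (b.k : ℕ) with hN
  set A := b.kind.gramMod N with hA
  have hdet : IsUnit A.det := b.kind.isUnit_det_gramMod _
  have ht (g : G) (i) : ∃ a, toQ N a = l.form g (x i) := by
    apply exists_toQ_eq
    rw [← map_nsmul, hk, map_zero]
  choose t ht using ht
  let ψ : G →+ b.Carrier := AddMonoidHom.mk' (fun g => t g) fun g h => by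
    funext i
    apply toQ_injective N
    rw [Pi.add_apply, map_add (toQ N), ht, ht, ht, map_add, AddMonoidHom.add_apply]
  have hψ (g : G) (i) : toQ N (ψ g i) = l.form g (x i) := ht g i
  let φ : b.Carrier →+ G :=
    ∑ i, (zmodHom N (x i) (hk _)).comp (Pi.evalAddMonoidHom (fun _ => ZMod N) i)
  have hφ (a : b.Carrier) : φ a = ∑ i, (a i).val • x i := by
    simp only [φ, AddMonoidHom.finsetSum_apply]
    exact Finset.sum_congr rfl fun i _ => zmodHom_apply N _ (hk _) _
  have hlφ (g : G) (a : b.Carrier) : l.form g (φ a) = toQ N (ψ g ⬝ᵥ a) := by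
    rw [hφ, map_sum, dotProduct, map_sum]
    refine Finset.sum_congr rfl fun i _ => ?_
    rw [map_nsmul, mul_comm, toQ_mul, hψ]
  have hψφ (a : b.Carrier) : ψ (φ a) = A *ᵥ a := by
    funext i
    apply toQ_injective N
    rw [hψ, l.symm, hlφ]
    congr 1
    rw [mulVec]
    congr 1
    funext j
    apply toQ_injective N
    rw [hψ, hx]
  -- `ψ g` lists the pairings of `g` with the `x i`; multiplying by the inverse Gram matrix turns
  -- them into the coordinates of the orthogonal projection.
  let p : G →+ b.Carrier := (Matrix.mulVecLin A⁻¹).toAddMonoidHom.comp ψ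
  have hp (g : G) : p g = A⁻¹ *ᵥ ψ g := rfl
  have hpψ (g : G) : A *ᵥ p g = ψ g := by
    rw [hp, mulVec_mulVec, Matrix.mul_nonsing_inv A hdet, one_mulVec]
  refine ⟨p.ker, exists_orthogonal_complement l b.pairing φ p ?_ ?_ ?_⟩
  · intro a
    rw [hp, hψφ, mulVec_mulVec, Matrix.nonsing_inv_mul A hdet, one_mulVec]
  · intro a c
    rw [hlφ, hψφ, b.pairing.symm, Block.pairing, LinkingPairing.ofMatrix_form, dotProduct_comm]
  · intro g a hg
    rw [hlφ, ← hpψ, hg]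
    simp

theorem isSumOfBlocks_option {G : Type} [AddCommGroup G] {l : LinkingPairing G} {b : Block}
    {K : AddSubgroup G} {lK : LinkingPairing K} (f : G ≃+ b.Carrier × K)
    (hf : ∀ x y, l.form x y = b.pairing.form (f x).1 (f y).1 + lK.form (f x).2 (f y).2)
    {ι : Type} [Fintype ι] {B : ι → Block} (h : IsSumOfBlocks lK B) :
    IsSumOfBlocks l (fun o : Option ι => o.elim b B) := by
  obtain ⟨g, hg⟩ := h
  let E : (b.Carrier × ∀ i, (B i).Carrier) ≃+ ∀ o : Option ι, (o.elim b B : Block).Carrier :=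
    { toEquiv := (Equiv.piOptionEquivProd
        (β := fun o : Option ι => (o.elim b B : Block).Carrier)).symm
      map_add' := by
        rintro ⟨a, p⟩ ⟨c, q⟩
        funext o
        cases o <;> rfl }
  refine ⟨(f.trans ((AddEquiv.refl _).prodCongr g)).trans E, fun x y => ?_⟩
  rw [hf, hg, LinkingPairing.pi_form, LinkingPairing.pi_form, Fintype.sum_option]
  rfl

theorem even_of_nsmul_eq_zero {k : ℕ} {z : ℤ} (h : 2 ^ k • (z : ZMod (2 ^ (k + 1))) = 0) :
    Even z := by
  have h1 : ((2 ^ k * z : ℤ) : ZMod (2 ^ (k + 1))) = 0 := by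
    rw [nsmul_eq_mul] at h; push_cast at h ⊢; exact h
  rw [ZMod.intCast_zmod_eq_zero_iff_dvd] at h1
  push_cast at h1
  rw [pow_succ] at h1
  exact even_iff_two_dvd.mpr (Int.dvd_of_mul_dvd_mul_left (by positivity) h1)

/-- Let `2^(k+1)` be the exponent of `G`. If some `λ(x, x)` has this order, `x` spans an odd block.
Otherwise all `λ(x, x)` have even numerator over `2^(k+1)`, and two vectors with `λ(x, y') =
1/2^(k+1)` span an even block. -/
theorem exists_split {G : Type} [AddCommGroup G] [Finite G] [Nontrivial G] {n : ℕ}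
    (hn : Nat.card G = 2 ^ n) (l : LinkingPairing G) :
    ∃ (b : Block) (K : AddSubgroup G) (lK : LinkingPairing K) (f : G ≃+ b.Carrier × K), ∀ x y,
      l.form x y = b.pairing.form (f x).1 (f y).1 + lK.form (f x).2 (f y).2 := by
  classical
  have hex : ∃ k, ∀ g : G, 2 ^ k • g = 0 := ⟨n, fun g => by rw [← hn]; exact card_nsmul_eq_zero'⟩
  obtain ⟨k, hk⟩ : ∃ k, Nat.find hex = k + 1 := by
    refine Nat.exists_eq_succ_of_ne_zero fun h => ?_
    have h0 := Nat.find_spec hex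
    rw [h] at h0
    obtain ⟨g, hg⟩ := exists_ne (0 : G)
    exact hg (by simpa using h0 g)
  have hkill : ∀ g : G, 2 ^ (k + 1) • g = 0 := by rw [← hk]; exact Nat.find_spec hex
  have hmin : ¬ ∀ g : G, 2 ^ k • g = 0 := Nat.find_min hex (by omega)
  push Not at hmin
  let K : ℕ+ := ⟨k + 1, Nat.succ_pos k⟩
  have hval (x y : G) : ∃ z : ℤ, l.form x y = toQ (2 ^ (k + 1)) (z : ZMod (2 ^ (k + 1))) := by
    obtain ⟨a, ha⟩ := exists_toQ_eq (2 ^ (k + 1)) (l.form x y) (by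
      rw [← map_nsmul, hkill, map_zero])
    obtain ⟨z, rfl⟩ := ZMod.intCast_surjective a
    exact ⟨z, ha.symm⟩
  have heven {x y : G} {z : ℤ} (hz : l.form x y = toQ (2 ^ (k + 1)) (z : ZMod (2 ^ (k + 1))))
      (h : 2 ^ k • l.form x y = 0) : Even z := by
    rw [hz, ← map_nsmul] at h
    exact even_of_nsmul_eq_zero (toQ_injective _ (h.trans (map_zero _).symm))
  have hodd {x y : G} {z : ℤ} (hz : l.form x y = toQ (2 ^ (k + 1)) (z : ZMod (2 ^ (k + 1))))
      (h : 2 ^ k • l.form x y ≠ 0) : Odd z := by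
    rw [← Int.not_even_iff_odd]
    rintro ⟨w, rfl⟩
    apply h
    rw [hz, ← map_nsmul, ← map_zero (toQ (2 ^ (k + 1)))]
    congr 1
    have : ((2 ^ (k + 1) : ℕ) : ZMod (2 ^ (k + 1))) * (w : ZMod (2 ^ (k + 1))) = 0 := by simp
    rw [nsmul_eq_mul, ← this]
    push_cast
    ring
  by_cases hd : ∃ x : G, 2 ^ k • l.form x x ≠ 0
  · obtain ⟨x, hx⟩ := hd
    obtain ⟨z, hz⟩ := hval x x
    obtain ⟨j, rfl⟩ := hodd hz hx
    refine ⟨⟨K, .odd j⟩, exists_split_block l ⟨K, .odd j⟩ hkill (fun _ => x) fun i i' => ?_⟩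
    rw [hz]
    change Fin 1 at i i'
    fin_cases i; fin_cases i'
    rfl
  · push Not at hd
    obtain ⟨x, hx⟩ := hmin
    -- Nondegeneracy applied to `2^k x ≠ 0` produces `y` with `λ(x, y)` of full order `2^(k+1)`.
    obtain ⟨y, hy⟩ : ∃ y, l.form (2 ^ k • x) y ≠ 0 := by
      by_contra! hcon
      exact hx (l.bijective_adjoint.1 (by rw [map_zero]; ext y; simpa using hcon y))
    have hxy : 2 ^ k • l.form x y ≠ 0 := by
      rwa [map_nsmul, AddMonoidHom.nsmul_apply] at hy
    obtain ⟨b, hb⟩ := hval x y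
    have hbu := isUnit_intCast_of_odd (hodd hb hxy) (k + 1)
    obtain ⟨c, hc⟩ := hbu.exists_right_inv
    -- Rescaling `y` by the inverse of the odd numerator of `λ(x, y)` makes the off-diagonal entry
    -- exactly `1`.
    let y' := c.val • y
    have hxy' : l.form x y' = toQ (2 ^ (k + 1)) 1 := by
      rw [map_nsmul, hb, ← toQ_mul, mul_comm, hc]
    obtain ⟨z, hz⟩ := hval x x
    obtain ⟨w, hw⟩ := hval y' y'
    obtain ⟨a, rfl⟩ := heven hz (hd x)
    obtain ⟨d, rfl⟩ := heven hw (hd y')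
    refine ⟨⟨K, .even a d⟩, exists_split_block l ⟨K, .even a d⟩ hkill ![x, y'] fun i i' => ?_⟩
    change Fin 2 at i i'
    fin_cases i <;> fin_cases i'
    · refine hz.trans (congrArg _ ?_)
      change ((a + a : ℤ) : ZMod (2 ^ (k + 1))) = ((2 * a : ℤ) : ZMod (2 ^ (k + 1)))
      rw [two_mul]
    · refine hxy'.trans (congrArg _ ?_)
      exact Int.cast_one.symm
    · refine (l.symm _ _).trans (hxy'.trans (congrArg _ ?_))
      exact Int.cast_one.symm
    · refine hw.trans (congrArg _ ?_)
      change ((d + d : ℤ) : ZMod (2 ^ (k + 1))) = ((2 * d : ℤ) : ZMod (2 ^ (k + 1)))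
      rw [two_mul]

theorem exists_isSumOfBlocks (n : ℕ) : ∀ (G : Type) [AddCommGroup G] [Finite G],
    Nat.card G = 2 ^ n → ∀ l : LinkingPairing G,
      ∃ (ι : Type) (_ : Fintype ι) (B : ι → Block), IsSumOfBlocks l B := by
  induction n using Nat.strong_induction_on with
  | _ n ih =>
    intro G _ _ hn l
    rcases subsingleton_or_nontrivial G with hG | hG
    · let _ : Unique G := ⟨⟨0⟩, fun _ => Subsingleton.elim _ _⟩
      refine ⟨Empty, inferInstance, Empty.elim, ⟨⟨Equiv.ofUnique G _, fun _ _ => Subsingleton.elim _ _⟩, fun x y => ?_⟩⟩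
      rw [Subsingleton.elim x 0, LinkingPairing.pi_form]; simp
    · obtain ⟨b, K, lK, f, hf⟩ := exists_split hn l
      have hcard : Nat.card G = Nat.card b.Carrier * Nat.card K := by
        rw [Nat.card_congr f.toEquiv, Nat.card_prod]
      obtain ⟨m, hm, hK⟩ := (Nat.dvd_prime_pow Nat.prime_two).mp
        (show Nat.card K ∣ 2 ^ n from hn ▸ Dvd.intro_left _ hcard.symm)
      have hb : 1 < Nat.card b.Carrier := by
        have : 1 < 2 ^ (b.k : ℕ) := Nat.one_lt_two_pow b.k.pos.ne'
        rw [Nat.card_fun, Nat.card_zmod, Nat.card_fin]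
        refine Nat.one_lt_pow ?_ this
        cases b.kind <;> simp [Kind.rank]
      have hmn : m < n := by
        rw [← Nat.pow_lt_pow_iff_right (show 1 < 2 by norm_num), ← hK, ← hn, hcard]
        have : 0 < Nat.card K := Nat.card_pos
        nlinarith
      obtain ⟨ι, _, B, hB⟩ := ih m hmn K hK lK
      exact ⟨Option ι, inferInstance, _, isSumOfBlocks_option f hf hB⟩

/-! ### Ranks -/

/-- The number of elements killed by `2^j`. -/
def torsionCard (M : Type*) [AddCommGroup M] (j : ℕ) : ℕ := Nat.card {x : M // 2 ^ j • x = 0}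

theorem torsionCard_congr {M M' : Type*} [AddCommGroup M] [AddCommGroup M'] (f : M ≃+ M')
    (j : ℕ) : torsionCard M j = torsionCard M' j :=
  Nat.card_congr (f.toEquiv.subtypeEquiv fun x => by
    change _ ↔ 2 ^ j • f x = 0
    rw [← map_nsmul, AddEquiv.map_eq_zero_iff])

theorem torsionCard_pi {ι : Type*} [Fintype ι] (M : ι → Type*) [∀ i, AddCommGroup (M i)]
    (j : ℕ) : torsionCard (∀ i, M i) j = ∏ i, torsionCard (M i) j := by
  unfold torsionCard
  rw [← Nat.card_pi]
  refine Nat.card_congr (Equiv.trans (Equiv.subtypeEquivRight fun x => ?_)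
    (Equiv.subtypePiEquivPi (p := fun i (y : M i) => 2 ^ j • y = 0)))
  rw [funext_iff]; rfl

theorem torsionCard_zmod (k j : ℕ) : torsionCard (ZMod (2 ^ k)) j = 2 ^ min k j := by
  have h := IsAddCyclic.card_nsmulAddMonoidHom_ker (ZMod (2 ^ k)) (2 ^ j)
  rw [Nat.card_zmod] at h
  have h2 : Nat.gcd (2 ^ k) (2 ^ j) = 2 ^ min k j := by
    rcases le_total k j with hkj | hkj
    · rw [min_eq_left hkj, Nat.gcd_eq_left (pow_dvd_pow 2 hkj)]
    · rw [min_eq_right hkj, Nat.gcd_eq_right (pow_dvd_pow 2 hkj)]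
  rw [← h2, ← h]
  rfl

/-- The `2^j`-torsion counts depend on the group alone and, as `j` varies, determine the ranks; this
is why `rho` is well defined. -/
theorem IsHomogeneousDecomposition.torsionCard_eq {G : Type*} [AddCommGroup G] [Finite G]
    {l : LinkingPairing G} {H : ℕ+ → AddSubgroup G} (hH : IsHomogeneousDecomposition l H)
    {n : ℕ+ → ℕ} (hn : ∀ k, Nonempty (H k ≃+ (Fin (n k) → ZMod (2 ^ (k : ℕ))))) :
    ∃ S : Finset ℕ+, (∀ k ∉ S, n k = 0) ∧
      ∀ j, torsionCard G j = 2 ^ ∑ k ∈ S, n k * min (k : ℕ) j := by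
  classical
  -- An independent family of subgroups of a finite group has only finitely many nonzero members.
  have hfin : {k | H k ≠ ⊥}.Finite :=
    WellFoundedGT.finite_ne_bot_of_iSupIndep hH.isInternal.addSubgroup_iSupIndep
  let S := hfin.toFinset
  have hS (k : ℕ+) (hk : k ∉ S) : H k = ⊥ := by simpa [S] using hk
  refine ⟨S, fun k hk => ?_, fun j => ?_⟩
  · obtain ⟨f⟩ := hn k
    have hs : Subsingleton (Fin (n k) → ZMod (2 ^ (k : ℕ))) := by
      have : Subsingleton (H k) := by rw [hS k hk]; infer_instance
      exact f.symm.injective.subsingleton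
    by_contra h0
    have hz : (1 : ZMod (2 ^ (k : ℕ))) = 0 :=
      congrFun (hs.elim (fun _ => 1) 0) (⟨0, Nat.pos_of_ne_zero h0⟩ : Fin (n k))
    have : Fact (1 < 2 ^ (k : ℕ)) := ⟨Nat.one_lt_two_pow k.pos.ne'⟩
    exact one_ne_zero hz
  · let f : (DirectSum ℕ+ fun k => H k) ≃+ G :=
      AddEquiv.ofBijective (DirectSum.coeAddMonoidHom H) hH.isInternal
    let g : (DirectSum ℕ+ fun k => H k) →+ (∀ k : S, H k) :=
      AddMonoidHom.mk' (fun x k => x k) fun x y => rfl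
    have hg : Function.Bijective g := by
      constructor
      · rw [injective_iff_map_eq_zero]
        intro x hx
        ext k
        by_cases hk : k ∈ S
        · have := congrFun hx ⟨k, hk⟩
          change x k = 0 at this
          rw [this]; rfl
        · have h0 : (x k : G) ∈ (⊥ : AddSubgroup G) := (hS k hk).le (x k).2
          rw [AddSubgroup.mem_bot.mp h0]; rfl
      · intro y
        refine ⟨DirectSum.mk (fun k => H k) S fun k => y k, ?_⟩
        funext k
        exact DirectSum.mk_apply_of_mem (β := fun k => H k) (f := fun k => y k) k.2
    rw [← torsionCard_congr f, torsionCard_congr (AddEquiv.ofBijective g hg), torsionCard_pi,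
      ← Finset.prod_pow_eq_pow_sum, ← Finset.prod_coe_sort S]
    refine Finset.prod_congr rfl fun k _ => ?_
    obtain ⟨f⟩ := hn k
    rw [torsionCard_congr f, torsionCard_pi]
    simp [torsionCard_zmod]
    rw [← pow_mul, mul_comm]

/-- The second difference of `j ↦ min i j` at `j = k` is `-1` if `i = k` and `0` otherwise, which
isolates `n k`. -/
theorem sum_mul_min (S : Finset ℕ+) (n : ℕ+ → ℕ) (k : ℕ+) (hS : k ∉ S → n k = 0) :
    ∑ i ∈ S, n i * min (i : ℕ) (k + 1) + ∑ i ∈ S, n i * min (i : ℕ) (k - 1) + n k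
      = 2 * ∑ i ∈ S, n i * min (i : ℕ) k := by
  classical
  have h1 : n k = ∑ i ∈ S, if i = k then n i else 0 := by
    rw [Finset.sum_ite_eq' S k]
    split_ifs with h
    · rfl
    · exact hS h
  rw [h1, ← Finset.sum_add_distrib, ← Finset.sum_add_distrib, Finset.mul_sum]
  refine Finset.sum_congr rfl fun i _ => ?_
  have hk := k.pos
  split_ifs with h
  · subst h
    rw [min_eq_left (by omega), min_eq_right (by omega), min_self]
    obtain ⟨c, hc⟩ : ∃ c, (i : ℕ) = c + 1 := ⟨i - 1, by omega⟩
    rw [hc, Nat.add_sub_cancel]; ring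
  · have hne : (i : ℕ) ≠ k := fun h' => h (PNat.coe_injective h')
    rcases Nat.lt_or_gt_of_ne hne with hlt | hgt
    · rw [min_eq_left (by omega), min_eq_left (by omega), min_eq_left (by omega)]; ring
    · rw [min_eq_right (by omega), min_eq_right (by omega), min_eq_right (by omega)]
      obtain ⟨c, hc⟩ : ∃ c, (k : ℕ) = c + 1 := ⟨k - 1, by omega⟩
      rw [hc, Nat.add_sub_cancel]; ring

theorem IsHomogeneousDecomposition.rank_unique {G : Type*} [AddCommGroup G] [Finite G]
    {l l' : LinkingPairing G} {H H' : ℕ+ → AddSubgroup G}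
    (hH : IsHomogeneousDecomposition l H) (hH' : IsHomogeneousDecomposition l' H') {k : ℕ+}
    {a b : ℕ} (ha : Nonempty (H k ≃+ (Fin a → ZMod (2 ^ (k : ℕ)))))
    (hb : Nonempty (H' k ≃+ (Fin b → ZMod (2 ^ (k : ℕ))))) : a = b := by
  classical
  have key {l : LinkingPairing G} {H : ℕ+ → AddSubgroup G} (hH : IsHomogeneousDecomposition l H)
      {a : ℕ} (ha : Nonempty (H k ≃+ (Fin a → ZMod (2 ^ (k : ℕ))))) :
      torsionCard G (k + 1) * torsionCard G (k - 1) * 2 ^ a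
        = torsionCard G k * torsionCard G k := by
    choose n hn using hH.free
    -- The given rank `a` is imposed at `k`; at the other indices any chosen rank serves, since
    -- these cancel in the second difference.
    obtain ⟨S, hS, hcard⟩ := hH.torsionCard_eq (n := Function.update n k a) fun i => by
      by_cases h : i = k
      · subst h; rw [Function.update_self]; exact ha
      · rw [Function.update_of_ne h]; exact hn i
    have := sum_mul_min S (Function.update n k a) k (hS k)
    rw [hcard, hcard, hcard, ← pow_add, ← pow_add, ← pow_add, ← two_mul, ← this]
    simp
  have h1 := (key hH ha).trans (key hH' hb).symm
  have hpos (j : ℕ) : 0 < torsionCard G j := by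
    have : Nonempty {x : G // 2 ^ j • x = 0} := ⟨⟨0, smul_zero _⟩⟩
    exact Nat.card_pos
  have h2 := Nat.eq_of_mul_eq_mul_left (Nat.mul_pos (hpos _) (hpos _)) h1
  exact Nat.pow_right_injective le_rfl h2

theorem IsHomogeneousDecomposition.rho_eq {G : Type*} [AddCommGroup G] [Finite G]
    {l : LinkingPairing G} {H : ℕ+ → AddSubgroup G} (hH : IsHomogeneousDecomposition l H)
    {k : ℕ+} {n : ℕ} (hn : Nonempty (H k ≃+ (Fin n → ZMod (2 ^ (k : ℕ))))) : rho l k = n := by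
  obtain ⟨H', hH', hn'⟩ := Classical.epsilon_spec
    (p := fun n : ℕ => ∃ H : ℕ+ → AddSubgroup G,
      IsHomogeneousDecomposition l H ∧ Nonempty (H k ≃+ (Fin n → ZMod (2 ^ (k : ℕ)))))
    ⟨n, H, hH, hn⟩
  exact hH'.rank_unique hH hn' hn

/-- The homogeneous component of a sum of blocks. -/
def homogeneousPart {G : Type} [AddCommGroup G] {ι : Type} (B : ι → Block)
    (f : G ≃+ (∀ i, (B i).Carrier)) (k : ℕ+) : AddSubgroup G where
  carrier := {g | ∀ i, (B i).k ≠ k → f g i = 0}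
  zero_mem' i _ := by rw [map_zero]; rfl
  add_mem' {a b} ha hb i hi := by rw [map_add, Pi.add_apply, ha i hi, hb i hi, add_zero]
  neg_mem' {a} ha i hi := by rw [map_neg, Pi.neg_apply, ha i hi, neg_zero]

theorem isInternal_homogeneousPart {G : Type} [AddCommGroup G] {ι : Type} [Fintype ι]
    (B : ι → Block) (f : G ≃+ (∀ i, (B i).Carrier)) :
    DirectSum.IsInternal (homogeneousPart B f) := by
  classical
  have key (x : DirectSum ℕ+ fun k => homogeneousPart B f k) (i : ι) :
      f (DirectSum.coeAddMonoidHom (homogeneousPart B f) x) i = f (x (B i).k : G) i := by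
    induction x using DirectSum.induction_on with
    | zero => simp
    | of k y =>
      rw [DirectSum.coeAddMonoidHom_of]
      by_cases h : k = (B i).k
      · subst h; rw [DirectSum.of_eq_same]
      · rw [DirectSum.of_eq_of_ne _ _ _ (Ne.symm h), y.2 i (Ne.symm h)]; simp
    | add x y hx hy => rw [map_add, map_add, Pi.add_apply, hx, hy]; simp
  constructor
  · rw [injective_iff_map_eq_zero]
    intro x hx
    ext k
    have : f (x k : G) = 0 := by
      funext i
      by_cases h : (B i).k = k
      · subst h; rw [← key, hx]; simp
      · exact (x k).2 i h
    simpa using this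
  · intro g
    have hsum : g = ∑ i, f.symm (Pi.single i (f g i)) := by
      rw [← map_sum, Finset.univ_sum_single, AddEquiv.symm_apply_apply]
    rw [← AddMonoidHom.mem_range, hsum]
    refine AddSubgroup.sum_mem _ fun i _ => ?_
    refine ⟨DirectSum.of (fun k => homogeneousPart B f k) (B i).k
      ⟨f.symm (Pi.single i (f g i)), fun j hj => ?_⟩, DirectSum.coeAddMonoidHom_of _ _ _⟩
    rw [AddEquiv.apply_symm_apply, Pi.single_eq_of_ne]
    rintro rfl; exact hj rfl

theorem nonempty_homogeneousPart_equiv {G : Type} [AddCommGroup G] {ι : Type} [Fintype ι]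
    (B : ι → Block) (f : G ≃+ (∀ i, (B i).Carrier)) (k : ℕ+) :
    Nonempty (homogeneousPart B f k ≃+ (Fin (familyRank B k) → ZMod (2 ^ (k : ℕ)))) := by
  classical
  let J := {i // (B i).k = k}
  let f₁ : homogeneousPart B f k ≃+ ∀ i : J, (B i).Carrier := AddEquiv.mk'
    ⟨fun g i => f (g : G) i,
      fun x => ⟨f.symm fun i => if h : (B i).k = k then x ⟨i, h⟩ else 0, fun i hi => by
        rw [AddEquiv.apply_symm_apply, dif_neg hi]⟩,
      fun g => by
        ext
        rw [AddEquiv.symm_apply_eq]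
        funext i
        split_ifs with h
        · rfl
        · exact (g.2 i h).symm,
      fun x => by
        funext i
        change f (f.symm _) i = x i
        rw [AddEquiv.apply_symm_apply, dif_pos i.2]⟩
    fun a b => by funext i; simp
  -- The moduli agree only through the equation `(B i).k = k`, so a transport of `ZMod` is needed
  -- before the coordinates can be concatenated.
  let f₂ : (∀ i : J, (B i).Carrier) ≃+
      ∀ i : J, (Fin (B i).kind.rank → ZMod (2 ^ (k : ℕ))) :=
    AddEquiv.piCongrRight fun i => AddEquiv.piCongrRight fun _ =>
      (ZMod.ringEquivCongr (by rw [i.2])).toAddEquiv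
  let f₃ : (∀ i : J, (Fin (B i).kind.rank → ZMod (2 ^ (k : ℕ)))) ≃+
      ((Σ i : J, Fin (B i).kind.rank) → ZMod (2 ^ (k : ℕ))) := AddEquiv.mk'
    (Equiv.piCurry fun (i : J) (_ : Fin (B i).kind.rank) => ZMod (2 ^ (k : ℕ))).symm
    fun a b => rfl
  have hcard : Fintype.card (Σ i : J, Fin (B i).kind.rank) = familyRank B k := by
    rw [Fintype.card_sigma, familyRank, ← Finset.sum_filter]
    simp only [Fintype.card_fin]
    rw [Finset.sum_subtype (p := fun i => (B i).k = k) _ (by simp)]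
  let f₄ : ((Σ i : J, Fin (B i).kind.rank) → ZMod (2 ^ (k : ℕ))) ≃+
      (Fin (familyRank B k) → ZMod (2 ^ (k : ℕ))) :=
    (AddEquiv.mk' (Equiv.arrowCongr (Fintype.equivFinOfCardEq hcard) (Equiv.refl _))
      fun a b => rfl)
  exact ⟨f₁.trans (f₂.trans (f₃.trans f₄))⟩

theorem IsSumOfBlocks.rho_eq {G : Type} [AddCommGroup G] [Finite G] {l : LinkingPairing G}
    {ι : Type} [Fintype ι] {B : ι → Block} (h : IsSumOfBlocks l B) (m : ℕ+) :
    rho l m = familyRank B m := by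
  obtain ⟨f, hf⟩ := h
  have hH : IsHomogeneousDecomposition l (homogeneousPart B f) :=
    { isInternal := isInternal_homogeneousPart B f
      orthogonal := by
        intro i j hij x hx y hy
        rw [hf, LinkingPairing.pi_form]
        refine Finset.sum_eq_zero fun a _ => ?_
        by_cases ha : (B a).k = i
        · rw [hy a (by rw [ha]; exact hij), map_zero]
        · rw [hx a ha, map_zero, AddMonoidHom.zero_apply]
      free := fun k => ⟨_, nonempty_homogeneousPart_equiv B f k⟩ }
  exact hH.rho_eq (nonempty_homogeneousPart_equiv B f m)

/-- A tableau is admissible if and only if it is the tableau of a sum of blocks. -/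
theorem admissible_iff_exists_blocks (T : FullTableau) :
    T.Admissible ↔ ∃ (ι : Type) (_ : Fintype ι) (B : ι → Block),
      ∀ m, T m = (familyRank B m, familySig B m) := by
  classical
  constructor
  · rintro ⟨G, _, _, l, ⟨n, hn⟩, hT⟩
    obtain ⟨ι, _, B, hB⟩ := exists_isSumOfBlocks n G hn l
    refine ⟨ι, inferInstance, B, fun m => Prod.ext ?_ ?_⟩
    · rw [← hB.rho_eq]; exact (hT m).1
    · rw [← hB.sigma_eq]; exact (hT m).2
  · rintro ⟨ι, _, B, hT⟩
    have hB : IsSumOfBlocks (LinkingPairing.pi fun i => (B i).pairing) B :=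
      ⟨AddEquiv.refl _, fun _ _ => rfl⟩
    refine ⟨∀ i, (B i).Carrier, inferInstance, inferInstance,
      LinkingPairing.pi fun i => (B i).pairing, ⟨∑ i, (B i).k * (B i).kind.rank, ?_⟩,
      fun m => ⟨?_, ?_⟩⟩
    · rw [Nat.card_pi, ← Finset.prod_pow_eq_pow_sum]
      refine Finset.prod_congr rfl fun i _ => ?_
      rw [Nat.card_fun, Nat.card_zmod, Nat.card_fin, pow_mul]
    · rw [hB.rho_eq, FullTableau.r, hT]
    · rw [hB.sigma_eq, FullTableau.s, hT]

/-! ### Necessity of the conditions -/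

/-- With `Kind.spec_of_not_isOdd`, this is all that necessity uses about the shape of a block. -/
theorem Kind.spec_of_isOdd {κ : Kind} (h : κ.IsOdd) :
    κ.rank = 1 ∧ (κ.u = 1 ∨ κ.u = -1) ∧ (κ.v = κ.u ∨ κ.v = κ.u + 4) := by
  cases κ with
  | even a c => exact h.elim
  | odd j =>
    have h8 : (2 * j + 1) % 8 = 1 ∨ (2 * j + 1) % 8 = 3 ∨ (2 * j + 1) % 8 = 5 ∨
        (2 * j + 1) % 8 = 7 := by omega
    have hv : Kind.v (.odd j) = (((2 * j + 1) % 8 : ℤ) : ZMod 8) := by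
      rw [Kind.v]; exact ((ZMod.intCast_mod _ 8)).symm
    have hu : Kind.u (.odd j) = if (2 * j + 1) % 4 = 1 then 1 else -1 := rfl
    rw [hu, hv]
    refine ⟨rfl, ?_⟩
    rcases h8 with h | h | h | h
    · rw [if_pos (by omega), h]; decide
    · rw [if_neg (by omega), h]; decide
    · rw [if_pos (by omega), h]; decide
    · rw [if_neg (by omega), h]; decide

theorem Kind.spec_of_not_isOdd {κ : Kind} (h : ¬ κ.IsOdd) :
    κ.rank = 2 ∧ (κ.u = 0 ∨ κ.u = 4) ∧ κ.v = 0 := by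
  cases κ with
  | odd j => exact (h trivial).elim
  | even a c =>
    refine ⟨rfl, ?_, rfl⟩
    simp only [Kind.u]
    split_ifs
    · exact Or.inr rfl
    · exact Or.inl rfl

theorem Block.sig_of_le {b : Block} {m : ℕ+} (h : b.k ≤ m) : b.sig m = 0 := if_pos h

theorem Block.sig_of_odd {b : Block} {m : ℕ+} (h : m < b.k) (ho : Odd ((b.k : ℕ) - m)) :
    b.sig m = b.kind.u := by
  rw [sig, if_neg (not_le.mpr h), if_pos ho]

theorem Block.sig_of_even {b : Block} {m : ℕ+} (h : m < b.k) (ho : ¬ Odd ((b.k : ℕ) - m)) :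
    b.sig m = b.kind.v := by
  rw [sig, if_neg (not_le.mpr h), if_neg ho]

/-- Rewrites a sum over columns as a sum over blocks, so that the congruences can be checked block
by block. -/
theorem finsum_familyRank {ι : Type} [Fintype ι] (B : ι → Block) (p : ℕ+ → Prop)
    [DecidablePred p] :
    ∑ᶠ (k : ℕ+) (_ : p k), familyRank B k = ∑ i, if p (B i).k then (B i).kind.rank else 0 := by
  classical
  have h1 (k : ℕ+) : ∑ᶠ (_ : p k), familyRank B k = if p k then familyRank B k else 0 := by
    rw [finsum_eq_if]
  simp only [h1]
  rw [finsum_eq_sum_of_support_subset (s := Finset.univ.image fun i => (B i).k)]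
  · have h2 (k : ℕ+) : (if p k then familyRank B k else 0)
        = ∑ i, if (B i).k = k then (if p k then (B i).kind.rank else 0) else 0 := by
      split_ifs
      · rfl
      · simp
    simp only [h2]
    rw [Finset.sum_comm]
    refine Finset.sum_congr rfl fun i _ => ?_
    rw [Finset.sum_ite_eq, if_pos (by simp)]
  · intro k hk
    by_contra hcon
    apply hk
    have : familyRank B k = 0 := Finset.sum_eq_zero fun i _ => if_neg fun h => hcon (by simp [← h])
    simp [this]

theorem not_isOdd_of_isRegularEntry {ι : Type} [Fintype ι] {B : ι → Block} {m : ℕ+}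
    (h : IsRegularEntry (familyRank B m, familySig B m)) {i : ι} (hi : (B i).k = m) :
    ¬ (B i).kind.IsOdd := by
  classical
  intro hodd
  rcases h with h | h
  · have := (Finset.sum_eq_zero_iff.mp h) i (Finset.mem_univ _)
    rw [if_pos hi, (Kind.spec_of_isOdd hodd).1] at this
    omega
  · exact h (if_pos ⟨i, hi, hodd⟩)

theorem familySig_of_isRegularEntry {ι : Type} [Fintype ι] {B : ι → Block} {m : ℕ+}
    (h : IsRegularEntry (familyRank B m, familySig B m)) :
    familySig B m = ((∑ i, (B i).sig m : ZMod 8) : Z8bar) :=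
  if_neg fun ⟨_, hi, hodd⟩ => not_isOdd_of_isRegularEntry h hi hodd

theorem sum_u_eq {ι : Type} {B : ι → Block} {s : Finset ι} (hs : ∀ i ∈ s, (B i).kind.IsOdd) :
    ∃ p ≤ ∑ i ∈ s, (B i).kind.rank,
      ∑ i ∈ s, (B i).kind.u = ((∑ i ∈ s, (B i).kind.rank : ℕ) : ZMod 8) - 2 * p := by
  classical
  induction s using Finset.induction_on with
  | empty => exact ⟨0, by simp⟩
  | insert a s ha ih =>
    obtain ⟨p, hp, hsum⟩ := ih fun i hi => hs i (by simp [hi])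
    obtain ⟨h1, hu, -⟩ := Kind.spec_of_isOdd (hs a (by simp))
    rw [Finset.sum_insert ha, Finset.sum_insert ha, hsum, h1]
    rcases hu with hu | hu
    · exact ⟨p, by omega, by rw [hu]; push_cast; ring⟩
    · exact ⟨p + 1, by omega, by rw [hu]; push_cast; ring⟩

section Necessity

variable {T : FullTableau} {ι : Type} [Fintype ι] {B : ι → Block}

theorem cond1_of_blocks (hT : ∀ m, T m = (familyRank B m, familySig B m)) : T.Cond1 := by
  classical
  intro m hm
  rw [FullTableau.IsRegular, hT] at hm
  rw [FullTableau.r, hT]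
  refine Finset.even_sum _ fun i _ => ?_
  split_ifs with h
  · rw [(Kind.spec_of_not_isOdd (not_isOdd_of_isRegularEntry hm h)).1]; exact even_two
  · exact Even.zero

theorem cond2_of_blocks (hT : ∀ m, T m = (familyRank B m, familySig B m)) : T.Cond2 := by
  classical
  intro m hm
  rw [FullTableau.IsRegular, hT] at hm
  have hr (k : ℕ+) : T.r k = familyRank B k := by rw [FullTableau.r, hT]
  simp only [hr, FullTableau.s, hT]
  rw [finsum_familyRank]
  refine ⟨_, familySig_of_isRegularEntry hm, ?_⟩
  have hd : 2 ∣ 8 := by norm_num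
  rw [← ZMod.castHom_apply (h := hd), map_sum, Nat.cast_sum]
  refine Finset.sum_congr rfl fun i _ => ?_
  rw [ZMod.castHom_apply]
  split_ifs with h
  · have hlt : m < (B i).k := PNat.add_one_le_iff.mp h
    by_cases ho : (B i).kind.IsOdd
    · obtain ⟨h1, hu, hv⟩ := Kind.spec_of_isOdd ho
      by_cases hp : Odd (((B i).k : ℕ) - m)
      · rw [Block.sig_of_odd hlt hp, h1]
        rcases hu with hu | hu <;> rw [hu] <;> decide
      · rw [Block.sig_of_even hlt hp, h1]
        rcases hv with hv | hv <;> rcases hu with hu | hu <;> rw [hv, hu] <;> decide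
    · obtain ⟨h1, hu, hv⟩ := Kind.spec_of_not_isOdd ho
      by_cases hp : Odd (((B i).k : ℕ) - m)
      · rw [Block.sig_of_odd hlt hp, h1]
        rcases hu with hu | hu <;> rw [hu] <;> decide
      · rw [Block.sig_of_even hlt hp, h1, hv]; decide
  · rw [Block.sig_of_le (by rw [PNat.add_one_le_iff, not_lt] at h; exact h)]; decide

theorem cond3_of_blocks (hT : ∀ m, T m = (familyRank B m, familySig B m)) : T.Cond3 := by
  classical
  intro m hm hm'
  rw [FullTableau.IsRegular, hT] at hm hm'
  have hr (k : ℕ+) : T.r k = familyRank B k := by rw [FullTableau.r, hT]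
  simp only [hr, FullTableau.s, hT]
  rw [finsum_familyRank, familySig_of_isRegularEntry hm, familySig_of_isRegularEntry hm']
  refine ⟨_, (WithTop.coe_add _ _).symm, ?_⟩
  have hd : 4 ∣ 8 := by norm_num
  rw [← ZMod.castHom_apply (h := hd), ← Finset.sum_add_distrib, map_sum,
    Finset.mul_sum, Nat.cast_sum]
  refine Finset.sum_congr rfl fun i _ => ?_
  rw [ZMod.castHom_apply]
  have hm1 : ((m + 1 : ℕ+) : ℕ) = m + 1 := rfl
  have hm2 : ((m + 2 : ℕ+) : ℕ) = m + 2 := rfl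
  rcases lt_trichotomy (B i).k (m + 1) with h | h | h
  · rw [if_neg (by rw [not_le, ← PNat.coe_lt_coe] at *; omega),
      Block.sig_of_le (by rw [← PNat.coe_le_coe]; rw [← PNat.coe_lt_coe] at h; omega),
      Block.sig_of_le h.le]
    decide
  -- A block at `m + 1` lies outside the rank sum, yet contributes `u` to `σ_m`. Regularity of `m +
  -- 1` makes it even, so `u` is `0` or `4` and vanishes modulo 4.
  · obtain ⟨h1, hu, hv⟩ := Kind.spec_of_not_isOdd (not_isOdd_of_isRegularEntry hm' h)
    rw [if_neg (by rw [not_le, ← PNat.coe_lt_coe, h]; omega), Block.sig_of_le h.le,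
      Block.sig_of_odd (by rw [← PNat.coe_lt_coe, h]; omega) (by
        rw [h, hm1, Nat.add_sub_cancel_left]; exact odd_one)]
    rcases hu with hu | hu <;> rw [hu] <;> decide
  · rw [← PNat.coe_lt_coe] at h
    have hlt : m < (B i).k := by rw [← PNat.coe_lt_coe]; omega
    have hlt' : m + 1 < (B i).k := by rw [← PNat.coe_lt_coe]; omega
    rw [if_pos (by rw [← PNat.coe_le_coe]; omega)]
    have hsum : (B i).sig m + (B i).sig (m + 1) = (B i).kind.u + (B i).kind.v := by
      by_cases hp : Odd (((B i).k : ℕ) - m)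
      · rw [Block.sig_of_odd hlt hp, Block.sig_of_even hlt' (by rw [Nat.odd_iff] at *; omega)]
      · rw [Block.sig_of_even hlt hp, Block.sig_of_odd hlt' (by rw [Nat.odd_iff] at *; omega),
          add_comm]
    rw [hsum]
    by_cases ho : (B i).kind.IsOdd
    · obtain ⟨h1, hu, hv⟩ := Kind.spec_of_isOdd ho
      rw [h1]
      rcases hv with hv | hv <;> rcases hu with hu | hu <;> rw [hv, hu] <;> decide
    · obtain ⟨h1, hu, hv⟩ := Kind.spec_of_not_isOdd ho
      rw [h1, hv]
      rcases hu with hu | hu <;> rw [hu] <;> decide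

theorem familySig_sub_of_single (hT : ∀ m, T m = (familyRank B m, familySig B m)) {m : ℕ+}
    (hn : T.IsRegular (m + 2)) {r : ℕ} (hr : r ≤ 2) (hi : T (m + 1) = (r, ⊤)) :
    ∃ p ≤ r, ∑ i, (B i).sig m - ∑ i, (B i).sig (m + 2) = (r : ZMod 8) - 2 * p := by
  classical
  rw [FullTableau.IsRegular, hT] at hn
  rw [hT, Prod.mk.injEq] at hi
  obtain ⟨hrank, htop⟩ := hi
  have hm1 : ((m + 1 : ℕ+) : ℕ) = m + 1 := rfl
  have hm2 : ((m + 2 : ℕ+) : ℕ) = m + 2 := rfl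
  obtain ⟨i₀, hi₀, ho₀⟩ : ∃ i, (B i).k = m + 1 ∧ (B i).kind.IsOdd := by
    by_contra hcon
    rw [familySig, if_neg hcon] at htop
    exact WithTop.coe_ne_top htop
  let s := Finset.univ.filter fun i => (B i).k = m + 1
  have hrs : ∑ i ∈ s, (B i).kind.rank = r := by
    rw [← hrank, familyRank, Finset.sum_filter]
  have hs : ∀ i ∈ s, (B i).kind.IsOdd := by
    intro i hi
    by_contra ho
    -- An even block next to the odd block `i₀` would give this column rank at least 3.
    have hne : i ≠ i₀ := by rintro rfl; exact ho ho₀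
    have hsub : ({i, i₀} : Finset ι) ⊆ s := by
      intro j hj
      rcases Finset.mem_insert.mp hj with rfl | hj
      · exact hi
      · rw [Finset.mem_singleton.mp hj]; simpa [s] using hi₀
    have := Finset.sum_le_sum_of_subset (f := fun i => (B i).kind.rank) hsub
    rw [hrs, Finset.sum_pair hne, (Kind.spec_of_not_isOdd ho).1, (Kind.spec_of_isOdd ho₀).1] at this
    omega
  obtain ⟨p, hp, hsum⟩ := sum_u_eq hs
  rw [hrs] at hp hsum
  refine ⟨p, hp, ?_⟩
  rw [← hsum, ← Finset.sum_sub_distrib, Finset.sum_filter]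
  refine Finset.sum_congr rfl fun i _ => ?_
  rcases lt_trichotomy (B i).k (m + 1) with h | h | h
  · rw [if_neg h.ne]
    rw [← PNat.coe_lt_coe] at h
    rw [Block.sig_of_le (by rw [← PNat.coe_le_coe]; omega),
      Block.sig_of_le (by rw [← PNat.coe_le_coe]; omega), sub_zero]
  · rw [if_pos h, Block.sig_of_le (m := m + 2) (by rw [← PNat.coe_le_coe, h]; omega),
      Block.sig_of_odd (by rw [← PNat.coe_lt_coe, h]; omega) (by
        rw [h, hm1, Nat.add_sub_cancel_left]; exact odd_one), sub_zero]
  · rw [if_neg h.ne']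
    rw [← PNat.coe_lt_coe] at h
    have hlt : m < (B i).k := by rw [← PNat.coe_lt_coe]; omega
    rcases eq_or_ne (B i).k (m + 2) with h2 | h2
    · obtain ⟨-, -, hv⟩ := Kind.spec_of_not_isOdd (not_isOdd_of_isRegularEntry hn h2)
      rw [Block.sig_of_le h2.le, Block.sig_of_even hlt (by
        rw [h2, hm2, Nat.add_sub_cancel_left]; decide), hv, sub_zero]
    · have hlt' : m + 2 < (B i).k := by
        rw [← PNat.coe_lt_coe]
        have : ((B i).k : ℕ) ≠ (m + 2 : ℕ+) := fun h => h2 (PNat.coe_injective h)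
        omega
      by_cases hp : Odd (((B i).k : ℕ) - m)
      · rw [Block.sig_of_odd hlt hp, Block.sig_of_odd hlt' (by rw [Nat.odd_iff] at *; omega),
          sub_self]
      · rw [Block.sig_of_even hlt hp, Block.sig_of_even hlt' (by rw [Nat.odd_iff] at *; omega),
          sub_self]

/-- If `n - m` is even and the block is not an odd one at `n`, it contributes to the difference of
the signatures at `m` and `n` only if its index lies strictly between `m` and `n`. -/
theorem Block.sig_sub_sig (b : Block) {m n : ℕ+} (hmn : m < n) (heven : Even ((n : ℕ) - m))
    (hn : b.k = n → ¬ b.kind.IsOdd) :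
    b.sig m - b.sig n = if m < b.k ∧ b.k < n then b.sig m else 0 := by
  rw [← PNat.coe_lt_coe] at hmn
  rw [Nat.even_iff] at heven
  rcases le_or_gt b.k m with h | hlt
  · rw [if_neg (fun h' => absurd h'.1 (not_lt.mpr h)), sig_of_le h,
      sig_of_le (h.trans (by rw [← PNat.coe_le_coe]; omega)), sub_zero]
  · rcases lt_trichotomy b.k n with h | h | h
    · rw [if_pos ⟨hlt, h⟩, sig_of_le h.le, sub_zero]
    -- A block at `n` contributes `v` to `σ_m`, as `n - m` is even; it is of even kind, so `v = 0`.
    · rw [if_neg (fun h' => absurd h'.2 (not_lt.mpr h.ge)), sig_of_le h.le,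
        sig_of_even hlt (by rw [h, Nat.odd_iff]; omega), (Kind.spec_of_not_isOdd (hn h)).2.2,
        sub_zero]
    · rw [if_neg (fun h' => absurd h'.2 (not_lt.mpr h.le))]
      have h1 := PNat.coe_lt_coe _ _ |>.mpr h
      by_cases hp : Odd ((b.k : ℕ) - m)
      · rw [sig_of_odd hlt hp, sig_of_odd h (by rw [Nat.odd_iff] at *; omega), sub_self]
      · rw [sig_of_even hlt hp, sig_of_even h (by rw [Nat.odd_iff] at *; omega), sub_self]

theorem ncard_of_delimiters {I : Set ℕ+} (hI : I.OrdConnected) {m b : ℕ+}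
    (hm : IsLeast I (m + 1)) (hb : IsGreatest I b) : I = Set.Icc (m + 1) b ∧
      I.ncard = (b : ℕ) - m := by
  have h : I = Set.Icc (m + 1) b :=
    Set.Subset.antisymm (fun x hx => ⟨hm.2 hx, hb.2 hx⟩) (hI.out hm.1 hb.1)
  refine ⟨h, ?_⟩
  rw [h, ← Finset.coe_Icc, Set.ncard_coe_finset, PNat.card_Icc]
  have : ((m + 1 : ℕ+) : ℕ) = m + 1 := rfl
  omega

theorem cond4_of_blocks (hT : ∀ m, T m = (familyRank B m, familySig B m)) : T.Cond4 := by
  classical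
  rintro I hI m n hm ⟨b, hb, rfl⟩ hmr hnr
  obtain ⟨hIcc, hcard⟩ := ncard_of_delimiters hI hm hb
  have hb1 : ((b + 1 : ℕ+) : ℕ) = b + 1 := rfl
  have hm1 : ((m + 1 : ℕ+) : ℕ) = m + 1 := rfl
  have hmb : m + 1 ≤ b := hb.2 hm.1
  rw [← PNat.coe_le_coe] at hmb
  have hmn : m < b + 1 := by rw [← PNat.coe_lt_coe]; omega
  have hmr' := hmr
  have hnr' := hnr
  rw [FullTableau.IsRegular, hT] at hmr' hnr'
  have hsm : T.s m = ((∑ i, (B i).sig m : ZMod 8) : Z8bar) := by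
    rw [FullTableau.s, hT]; exact familySig_of_isRegularEntry hmr'
  have hsn : T.s (b + 1) = ((∑ i, (B i).sig (b + 1) : ZMod 8) : Z8bar) := by
    rw [FullTableau.s, hT]; exact familySig_of_isRegularEntry hnr'
  have hmem {k : ℕ+} (h : m < k ∧ k < b + 1) : k ∈ I := by
    rw [hIcc]; exact ⟨PNat.add_one_le_iff.mpr h.1, PNat.lt_add_one_iff.mp h.2⟩
  have hodd (h : Odd I.ncard) : Even (((b + 1 : ℕ+) : ℕ) - m) := by
    rw [hcard, Nat.odd_iff] at h
    rw [Nat.even_iff]; omega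
  have hsing (h : I.ncard = 1) : b = m + 1 := by
    rw [hcard] at h
    apply PNat.coe_injective
    change (b : ℕ) = m + 1
    omega
  refine ⟨?_, ?_, ?_, ?_⟩
  · rintro ⟨h, hr⟩
    refine ⟨_, _, hsm, hsn, ?_⟩
    rw [Set.mem_singleton_iff, ← Finset.sum_sub_distrib]
    refine Finset.sum_eq_zero fun i _ => ?_
    rw [Block.sig_sub_sig _ hmn (hodd h) (not_isOdd_of_isRegularEntry hnr'), if_neg]
    intro hk
    have h0 := hr ⟨_, hmem hk⟩
    change (T (B i).k).1 = 0 at h0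
    rw [hT] at h0
    have h1 := (Finset.sum_eq_zero_iff.mp h0) i (Finset.mem_univ _)
    rw [if_pos rfl] at h1
    by_cases ho : (B i).kind.IsOdd
    · rw [(Kind.spec_of_isOdd ho).1] at h1; omega
    · rw [(Kind.spec_of_not_isOdd ho).1] at h1; omega
  · rintro ⟨h, hr⟩
    obtain rfl := hsing h
    obtain ⟨p, hp, hsub⟩ := familySig_sub_of_single hT hnr (r := 1) (by omega) (hr ⟨_, hm.1⟩)
    refine ⟨_, _, hsm, hsn, ?_⟩
    change ∑ i, (B i).sig m - ∑ i, (B i).sig (m + 2) ∈ _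
    rw [hsub]
    interval_cases p <;> decide
  · rintro ⟨h, hr⟩
    obtain rfl := hsing h
    obtain ⟨p, hp, hsub⟩ := familySig_sub_of_single hT hnr (r := 2) (by omega) (hr ⟨_, hm.1⟩)
    refine ⟨_, _, hsm, hsn, ?_⟩
    change ∑ i, (B i).sig m - ∑ i, (B i).sig (m + 2) ∈ _
    rw [hsub]
    interval_cases p <;> decide
  · rintro ⟨h, hr⟩
    refine ⟨_, _, hsm, hsn, ?_⟩
    -- In `ℤ/8` the subgroup `{0, 4}` is the kernel of multiplication by 2, so membership can be
    -- tested blockwise.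
    have key : 2 * (∑ i, (B i).sig m - ∑ i, (B i).sig (b + 1)) = 0 := by
      rw [← Finset.sum_sub_distrib, Finset.mul_sum]
      refine Finset.sum_eq_zero fun i _ => ?_
      rw [Block.sig_sub_sig _ hmn (hodd h) (not_isOdd_of_isRegularEntry hnr')]
      split_ifs with hk
      · have hreg := hr ⟨_, hmem hk⟩
        change IsRegularEntry (T (B i).k) at hreg
        rw [hT] at hreg
        obtain ⟨-, hu, hv⟩ := Kind.spec_of_not_isOdd (not_isOdd_of_isRegularEntry hreg rfl)
        by_cases hp : Odd (((B i).k : ℕ) - m)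
        · rw [Block.sig_of_odd hk.1 hp]
          rcases hu with hu | hu <;> rw [hu] <;> decide
        · rw [Block.sig_of_even hk.1 hp, hv, mul_zero]
      · exact mul_zero _
    have hdec : ∀ z : ZMod 8, 2 * z = 0 → z ∈ ({0, 4} : Set (ZMod 8)) := by
      intro z hz
      have : ∀ z : ZMod 8, 2 * z = 0 → z = 0 ∨ z = 4 := by decide
      exact this z hz
    exact hdec _ key

end Necessity

/-! ### Sufficiency of the conditions -/

/-- Take `r + 1` odd blocks, `p` of them with `u = -1`. Only the base block carries the shift `w`,
through the choice among the units `1, 5, 7, 3` modulo 8; every block added later has `v = u`. -/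
theorem exists_odd_kinds (r p : ℕ) (hp : p ≤ r + 1) (w : ZMod 8) (hw : w = 0 ∨ w = 4) :
    ∃ (ι : Type) (_ : Fintype ι) (κ : ι → Kind), Nonempty ι ∧ (∀ i, (κ i).IsOdd) ∧
      ∑ i, (κ i).rank = r + 1 ∧ ∑ i, (κ i).u = ((r + 1 : ℕ) : ZMod 8) - 2 * p ∧
      ∑ i, (κ i).v = ((r + 1 : ℕ) : ZMod 8) - 2 * p + w := by
  induction r generalizing p with
  | zero =>
    have h : ∃ j : ℤ, Kind.u (.odd j) = 1 - 2 * p ∧ Kind.v (.odd j) = 1 - 2 * p + w := by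
      interval_cases p <;> rcases hw with rfl | rfl
      · exact ⟨0, by decide, by decide⟩
      · exact ⟨2, by decide, by decide⟩
      · exact ⟨3, by decide, by decide⟩
      · exact ⟨1, by decide, by decide⟩
    obtain ⟨j, hu, hv⟩ := h
    exact ⟨Unit, inferInstance, fun _ => .odd j, inferInstance, fun _ => trivial, by simp,
      by simpa using hu, by simpa using hv⟩
  | succ r ih =>
    -- Add the unit `1` unless all `r + 2` blocks must have `u = -1`, in which case add the unit
    -- `7`; `q` counts the negative signs left to the others.
    have h : ∃ (j : ℤ) (q : ℕ), q ≤ r + 1 ∧ Kind.u (.odd j) = 1 - 2 * (p - q) ∧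
        Kind.v (.odd j) = 1 - 2 * (p - q) := by
      rcases Nat.lt_or_ge p (r + 2) with h | h
      · refine ⟨0, p, by omega, ?_, ?_⟩ <;> rw [sub_self] <;> decide
      · obtain rfl : p = r + 1 + 1 := by omega
        refine ⟨3, r + 1, le_rfl, ?_, ?_⟩ <;> push_cast <;> rw [add_sub_cancel_left] <;> decide
    obtain ⟨j, q, hq, hu, hv⟩ := h
    obtain ⟨ι, _, κ, -, hodd, hr, hsu, hsv⟩ := ih q hq
    refine ⟨Option ι, inferInstance, fun o => o.elim (.odd j) κ, inferInstance, ?_, ?_, ?_, ?_⟩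
    · rintro (_ | i)
      · trivial
      · exact hodd i
    · have hk : (Kind.odd j).rank = 1 := rfl
      simp only [Fintype.sum_option, Option.elim, hr, hk]; omega
    · simp only [Fintype.sum_option, Option.elim, hsu, hu]; push_cast; ring
    · simp only [Fintype.sum_option, Option.elim, hsv, hv]; push_cast; ring

/-- One block realizes `u` through its Arf invariant and the others contribute `0`; with no block
available, `u` must be `0`. -/
theorem exists_even_kinds (a : ℕ) (u : ZMod 8) (hu : u = 0 ∨ u = 4) (h0 : a = 0 → u = 0) :
    ∃ (ι : Type) (_ : Fintype ι) (κ : ι → Kind), (∀ i, ¬ (κ i).IsOdd) ∧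
      ∑ i, (κ i).rank = a + a ∧ ∑ i, (κ i).u = u ∧ ∑ i, (κ i).v = 0 := by
  have hz : Kind.u (.even 0 0) = 0 := by simp [Kind.u]
  cases a with
  | zero => exact ⟨Empty, inferInstance, Empty.elim, fun i => i.elim, by simp, by simp [h0],
      by simp⟩
  | succ a =>
    have h : ∃ b : ℤ, Kind.u (.even b b) = u := by
      rcases hu with rfl | rfl
      · exact ⟨0, hz⟩
      · exact ⟨1, by simp [Kind.u]⟩
    obtain ⟨b, hb⟩ := h
    refine ⟨Option (Fin a), inferInstance, fun o => o.elim (.even b b) fun _ => .even 0 0,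
      ?_, ?_, ?_, ?_⟩
    · rintro (_ | i) <;> exact id
    · have hk (x y : ℤ) : (Kind.even x y).rank = 2 := rfl
      simp only [Fintype.sum_option, Option.elim, Finset.sum_const, Finset.card_univ,
        Fintype.card_fin, smul_eq_mul, hk]; omega
    · simp [Fintype.sum_option, hb, hz]
    · simp [Fintype.sum_option, Kind.v]

/-! ### Parity bookkeeping for the descending construction -/

/-- The contribution of a block to `σ_m` for `m = k - 1`. -/
def Block.near (b : Block) (k : ℕ+) : ZMod 8 :=
  if Odd ((b.k : ℕ) - k) then b.kind.v else b.kind.u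

/-- The contribution of a block to `σ_m` for `m = k - 2`. -/
def Block.far (b : Block) (k : ℕ+) : ZMod 8 :=
  if Odd ((b.k : ℕ) - k) then b.kind.u else b.kind.v

/-- Lowering `k` by one flips the parity of the distance, so for blocks already placed `near` and
`far` exchange roles. -/
theorem Block.near_eq_far {b : Block} {k : ℕ+} (h : k + 1 ≤ b.k) : b.near k = b.far (k + 1) := by
  rw [← PNat.coe_le_coe] at h
  have hk : ((k + 1 : ℕ+) : ℕ) = k + 1 := rfl
  have : Odd ((b.k : ℕ) - k) ↔ ¬ Odd ((b.k : ℕ) - (k + 1 : ℕ+)) := by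
    rw [Nat.odd_iff, Nat.odd_iff]; omega
  rw [near, far]
  split_ifs <;> tauto

theorem Block.far_eq_near {b : Block} {k : ℕ+} (h : k + 1 ≤ b.k) : b.far k = b.near (k + 1) := by
  rw [← PNat.coe_le_coe] at h
  have hk : ((k + 1 : ℕ+) : ℕ) = k + 1 := rfl
  have : Odd ((b.k : ℕ) - k) ↔ ¬ Odd ((b.k : ℕ) - (k + 1 : ℕ+)) := by
    rw [Nat.odd_iff, Nat.odd_iff]; omega
  rw [near, far]
  split_ifs <;> tauto

theorem Block.near_self (b : Block) : b.near b.k = b.kind.u := by simp [near]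

theorem Block.far_self (b : Block) : b.far b.k = b.kind.v := by simp [far]

theorem Block.sig_eq_near {b : Block} {m : ℕ+} (h : m + 1 ≤ b.k) : b.sig m = b.near (m + 1) := by
  have hlt : m < b.k := PNat.add_one_le_iff.mp h
  rw [← PNat.coe_le_coe] at h
  have hk : ((m + 1 : ℕ+) : ℕ) = m + 1 := rfl
  have : Odd ((b.k : ℕ) - m) ↔ ¬ Odd ((b.k : ℕ) - (m + 1 : ℕ+)) := by
    rw [Nat.odd_iff, Nat.odd_iff]; omega
  rw [sig, near, if_neg (not_le.mpr hlt)]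
  split_ifs <;> tauto

/-- The possible contributions to `σ_{m-1}` of a homogeneous pairing with entry `T m`. -/
def FullTableau.IsIncrement (T : FullTableau) (m : ℕ+) (x : ZMod 8) : Prop :=
  (T.IsRegular m → (x = 0 ∨ x = 4) ∧ (T.r m = 0 → x = 0)) ∧
    (¬ T.IsRegular m → ∃ p ≤ T.r m, x = (T.r m : ZMod 8) - 2 * p)

/-- The sum of the formal ranks from `k` on. -/
def FullTableau.tailRank (T : FullTableau) (k : ℕ+) : ℕ := ∑ᶠ (j : ℕ+) (_ : k ≤ j), T.r j

/-- The formal signature, with `∞` replaced by `0`. -/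
def FullTableau.sVal (T : FullTableau) (m : ℕ+) : ZMod 8 := (T.s m).untopD 0

theorem FullTableau.one_le_r {T : FullTableau} {m : ℕ+} (h : ¬ T.IsRegular m) : 1 ≤ T.r m := by
  rw [Nat.one_le_iff_ne_zero]; exact fun h' => h (Or.inl h')

theorem FullTableau.s_eq_top {T : FullTableau} {m : ℕ+} (h : ¬ T.IsRegular m) : T.s m = ⊤ := by
  by_contra h'; exact h (Or.inr h')

theorem FullTableau.tailRank_eq {T : FullTableau} (hT : T.IsFinite) (k : ℕ+) :
    T.tailRank k = T.r k + T.tailRank (k + 1) := by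
  have hfin : ((Set.Ici (k + 1)) ∩ Function.support fun j => T.r j).Finite :=
    (hT.subset fun j hj => by
      intro h0
      apply hj
      change (T j).1 = 0
      rw [h0]; rfl).inter_of_right _
  have hset : (Set.Ici k : Set ℕ+) = insert k (Set.Ici (k + 1)) := by
    ext j
    rw [Set.mem_insert_iff, Set.mem_Ici, Set.mem_Ici, PNat.add_one_le_iff, le_iff_eq_or_lt,
      eq_comm]
  change ∑ᶠ j ∈ Set.Ici k, T.r j = T.r k + ∑ᶠ j ∈ Set.Ici (k + 1), T.r j
  rw [hset, finsum_mem_insert' _ _ hfin]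
  simp only [Set.mem_Ici, PNat.add_one_le_iff, lt_irrefl, not_false_eq_true]

/-- In `ℤ/8`, congruence modulo 2 is expressed as `4 * x = 4 * y`, and congruence modulo 4 as `2 * x
= 2 * y`; this lets `linear_combination` combine the conditions. -/
theorem FullTableau.Cond2.sVal_spec {T : FullTableau} (h : T.Cond2) {m : ℕ+}
    (hm : T.IsRegular m) :
    T.s m = (T.sVal m : Z8bar) ∧ 4 * T.sVal m = 4 * (T.tailRank (m + 1) : ZMod 8) := by
  obtain ⟨x, hx, hc⟩ := h m hm
  have hv : T.sVal m = x := by rw [sVal, hx]; rfl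
  rw [hv]
  refine ⟨hx, ?_⟩
  have hd : 2 ∣ 8 := by norm_num
  have key : ∀ x y : ZMod 8, (x.cast : ZMod 2) = (y.cast : ZMod 2) → 4 * x = 4 * y := by decide
  apply key
  rw [hc, ZMod.cast_natCast hd]; rfl

/-- By (2) at `m + 1`, the right side of (3) is `2 s(m+1)` modulo 4, so (3) amounts to `s(m) ≡
s(m+1)` modulo 4. -/
theorem FullTableau.Cond3.sVal_congr {T : FullTableau} (h : T.Cond3) (h2 : T.Cond2) {m : ℕ+}
    (hm : T.IsRegular m) (hm' : T.IsRegular (m + 1)) : 2 * T.sVal m = 2 * T.sVal (m + 1) := by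
  obtain ⟨x, hx, hc⟩ := h m hm hm'
  obtain ⟨h1, -⟩ := h2.sVal_spec hm
  obtain ⟨h1', h4⟩ := h2.sVal_spec hm'
  rw [h1, h1', ← WithTop.coe_add, WithTop.coe_inj] at hx
  have hd : 4 ∣ 8 := by norm_num
  have key : ∀ x y : ZMod 8, (x.cast : ZMod 4) = (y.cast : ZMod 4) → 2 * x = 2 * y := by decide
  have h3 : 2 * x = 2 * ((2 * T.tailRank (m + 1 + 1) : ℕ) : ZMod 8) := by
    apply key
    rw [hc, ZMod.cast_natCast hd]; rfl
  rw [← hx] at h3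
  push_cast at h3
  linear_combination h3 - h4

theorem four_mul_eq_of_even {n : ℕ} (h : Even n) : 4 * (n : ZMod 8) = 0 := by
  obtain ⟨a, rfl⟩ := h
  have h8 : (8 : ZMod 8) = 0 := by decide
  push_cast
  linear_combination (a : ZMod 8) * h8

theorem FullTableau.IsIncrement.four_mul {T : FullTableau} (h1 : T.Cond1) {m : ℕ+} {x : ZMod 8}
    (hx : T.IsIncrement m x) : 4 * x = 4 * (T.r m : ZMod 8) := by
  have h8 : (8 : ZMod 8) = 0 := by decide
  by_cases hm : T.IsRegular m
  · rw [four_mul_eq_of_even (h1 m hm)]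
    rcases (hx.1 hm).1 with rfl | rfl <;> decide
  · obtain ⟨p, -, rfl⟩ := hx.2 hm
    linear_combination (-(p : ZMod 8)) * h8

/-- This is where (4) enters, for `I = {m + 1}`: types `T₀` and `T₃` handle a regular column, `T₁`
and `T₂` an irregular one of rank at most 2. -/
theorem isIncrement_sub {T : FullTableau} (hT : T.IsFinite) (h1 : T.Cond1) (h2 : T.Cond2)
    (h4 : T.Cond4) {m : ℕ+} (hm : T.IsRegular m) (hm' : T.IsRegular (m + 2)) :
    T.IsIncrement (m + 1) (T.sVal m - T.sVal (m + 2)) := by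
  obtain ⟨hs, hp⟩ := h2.sVal_spec hm
  obtain ⟨hs', hp'⟩ := h2.sVal_spec hm'
  obtain ⟨t0, t1, t2, t3⟩ := h4 {m + 1} Set.ordConnected_singleton m (m + 2) isLeast_singleton
    ⟨m + 1, isGreatest_singleton, rfl⟩ hm hm'
  have hmem {D : Set (ZMod 8)} (h : DiffMem (T.s m) (T.s (m + 2)) D) :
      T.sVal m - T.sVal (m + 2) ∈ D := by
    obtain ⟨x, y, hx, hy, hD⟩ := h
    rw [hs, WithTop.coe_inj] at hx
    rw [hs', WithTop.coe_inj] at hy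
    rwa [hx, hy]
  have hodd : Odd (({m + 1} : Set ℕ+).ncard) := by rw [Set.ncard_singleton]; exact odd_one
  refine ⟨fun hr => ⟨?_, fun h0 => ?_⟩, fun hr => ?_⟩
  · exact hmem (t3 ⟨hodd, by rintro ⟨_, rfl⟩; exact hr⟩)
  · exact hmem (t0 ⟨hodd, by rintro ⟨_, rfl⟩; exact h0⟩)
  · have hr1 := FullTableau.one_le_r hr
    have htop := FullTableau.s_eq_top hr
    rcases Nat.lt_or_ge (T.r (m + 1)) 3 with hlt | hge
    · obtain h | h : T.r (m + 1) = 1 ∨ T.r (m + 1) = 2 := by omega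
      · have hd := hmem (t1 ⟨Set.ncard_singleton _, by rintro ⟨_, rfl⟩; exact Prod.ext h htop⟩)
        rw [h]
        rcases hd with hd | hd <;> rw [hd]
        · exact ⟨0, by omega, by decide⟩
        · exact ⟨1, by omega, by decide⟩
      · have hd := hmem (t2 ⟨Set.ncard_singleton _, by rintro ⟨_, rfl⟩; exact Prod.ext h htop⟩)
        rw [h]
        rcases hd with hd | hd | hd <;> rw [hd]
        · exact ⟨1, by omega, by decide⟩
        · exact ⟨0, by omega, by decide⟩
        · exact ⟨2, by omega, by decide⟩
    -- For rank at least 3 parity suffices: the values `r - 2p` with `p = 0, 1, 2, 3` exhaust a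
    -- parity class of `ℤ/8`, and (1) at `m + 2` removes its rank from the parity count.
    · have hev := four_mul_eq_of_even (h1 _ hm')
      have e1 : T.tailRank (m + 1) = T.r (m + 1) + (T.r (m + 2) + T.tailRank (m + 2 + 1)) := by
        rw [T.tailRank_eq hT (m + 1), T.tailRank_eq hT (m + 1 + 1)]; rfl
      rw [e1] at hp
      push_cast at hp
      have hpar : 4 * (T.sVal m - T.sVal (m + 2)) = 4 * (T.r (m + 1) : ZMod 8) := by
        linear_combination hp - hp' + hev
      have key : ∀ x y : ZMod 8, 4 * x = 4 * y →
          x = y - 2 * (0 : ℕ) ∨ x = y - 2 * (1 : ℕ) ∨ x = y - 2 * (2 : ℕ) ∨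
            x = y - 2 * (3 : ℕ) := by decide
      rcases key _ _ hpar with h | h | h | h
      · exact ⟨0, by omega, h⟩
      · exact ⟨1, by omega, h⟩
      · exact ⟨2, by omega, h⟩
      · exact ⟨3, by omega, h⟩

/-- The blocks of a family at indices `≥ k` realize the tableau `T` from `k` on, and leave no
obstruction to realizing the two preceding entries. -/
structure Realizes (T : FullTableau) (k : ℕ+) {ι : Type} [Fintype ι] (B : ι → Block) : Prop where
  le : ∀ i, k ≤ (B i).k
  rank : ∀ m, k ≤ m → familyRank B m = T.r m
  odd : ∀ m, k ≤ m → ((∃ i, (B i).k = m ∧ (B i).kind.IsOdd) ↔ ¬ T.IsRegular m)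
  sig : ∀ m, k ≤ m → T.IsRegular m → T.sVal m = ∑ i, (B i).sig m
  -- Column `k - 1` adds nothing to its own finite signature, so `near` is an equality; it does
  -- contribute to `σ_{k-2}`, so `far` only requires the discrepancy to be attainable. Either clause
  -- is vacuous when there is no such `m`.
  near : ∀ m, m + 1 = k → T.IsRegular m → T.sVal m = ∑ i, (B i).near k
  far : ∀ m, m + 2 = k → T.IsRegular m → T.IsIncrement (m + 1) (T.sVal m - ∑ i, (B i).far k)
  congr : 2 * ∑ i, (B i).near k = 2 * ∑ i, (B i).far k
  parity : 4 * ∑ i, (B i).near k = 4 * (T.tailRank k : ZMod 8)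

theorem exists_isIncrement (T : FullTableau) (m : ℕ+) : ∃ x, T.IsIncrement m x := by
  by_cases h : T.IsRegular m
  · exact ⟨0, fun _ => ⟨Or.inl rfl, fun _ => rfl⟩, fun h' => absurd h h'⟩
  · exact ⟨T.r m, fun h' => absurd h' h, fun _ => ⟨0, Nat.zero_le _, by simp⟩⟩

/-- The choice made at column `k`: here `q₁` and `q₂` are what the columns beyond `k` contribute to
`σ_k` and `σ_{k-1}`. The value `u` settles `σ_{k-1}`, and `v` must leave column `k - 1` an
attainable increment for `σ_{k-2}`. -/
theorem exists_increments {T : FullTableau} (hT : T.IsFinite) (h1 : T.Cond1) (h2 : T.Cond2)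
    (h3 : T.Cond3) (h4 : T.Cond4) {k : ℕ+} {q₁ q₂ : ZMod 8}
    (hnear : T.IsRegular k → T.sVal k = q₁)
    (hfar : ∀ m, m + 1 = k → T.IsRegular m → T.IsIncrement k (T.sVal m - q₂))
    (hcongr : 2 * q₁ = 2 * q₂) (hpar : 4 * q₁ = 4 * (T.tailRank (k + 1) : ZMod 8)) :
    ∃ u v, T.IsIncrement k u ∧ (T.IsRegular k → v = 0) ∧
      (¬ T.IsRegular k → v = u ∨ v = u + 4) ∧
      (∀ m, m + 1 = k → T.IsRegular m → T.sVal m = q₂ + u) ∧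
      ∀ m, m + 2 = k → T.IsRegular m → T.IsIncrement (m + 1) (T.sVal m - (q₁ + v)) := by
  have hu : ∃ u, T.IsIncrement k u ∧ ∀ m, m + 1 = k → T.IsRegular m → T.sVal m = q₂ + u := by
    by_cases h : ∃ m, m + 1 = k ∧ T.IsRegular m
    · obtain ⟨m, hm, hr⟩ := h
      refine ⟨_, hfar m hm hr, fun m' hm' _ => ?_⟩
      obtain rfl : m' = m := add_right_cancel (hm'.trans hm.symm)
      ring
    · obtain ⟨x, hx⟩ := exists_isIncrement T k
      exact ⟨x, hx, fun m hm hr => (h ⟨m, hm, hr⟩).elim⟩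
  obtain ⟨u, hinc, hu⟩ := hu
  by_cases hk : T.IsRegular k
  · refine ⟨u, 0, hinc, fun _ => rfl, fun h => absurd hk h, hu, fun m hm hr => ?_⟩
    subst hm
    rw [add_zero, ← hnear hk]
    exact isIncrement_sub hT h1 h2 h4 hr hk
  · have hv : ∃ v, (v = u ∨ v = u + 4) ∧
        ∀ m, m + 2 = k → T.IsRegular m → T.IsIncrement (m + 1) (T.sVal m - (q₁ + v)) := by
      by_cases h : ∃ m, m + 2 = k ∧ T.IsRegular m
      · obtain ⟨m, rfl, hr⟩ := h
        suffices hs : ∃ v, (v = u ∨ v = u + 4) ∧ T.IsIncrement (m + 1) (T.sVal m - (q₁ + v)) by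
          obtain ⟨v, hv, hi⟩ := hs
          refine ⟨v, hv, fun m' hm' _ => ?_⟩
          obtain rfl : m' = m := add_right_cancel hm'
          exact hi
        -- If column `k - 1` is regular, (3) makes its demand `0` or `4`; choosing between `v = u`
        -- and `v = u + 4` brings it to `0`, which is attainable even at rank `0`.
        by_cases hr' : T.IsRegular (m + 1)
        · have hx : 2 * (T.sVal m - (q₁ + u)) = 0 := by
            have e1 := h3.sVal_congr h2 hr hr'
            have e2 := hu (m + 1) rfl hr'
            linear_combination e1 + 2 * e2 - hcongr
          have key : ∀ x q u : ZMod 8, 2 * (x - (q + u)) = 0 →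
              x - (q + u) = 0 ∨ x - (q + (u + 4)) = 0 := by decide
          have hz : T.IsIncrement (m + 1) 0 :=
            ⟨fun _ => ⟨Or.inl rfl, fun _ => rfl⟩, fun h => absurd hr' h⟩
          rcases key _ _ _ hx with h | h
          · exact ⟨u, Or.inl rfl, by rw [h]; exact hz⟩
          · exact ⟨u + 4, Or.inr rfl, by rw [h]; exact hz⟩
        · have hr1 := FullTableau.one_le_r hr'
          have hx : 4 * (T.sVal m - (q₁ + u)) = 4 * (T.r (m + 1) : ZMod 8) := by
            have e1 := (h2.sVal_spec hr).2
            have e2 : T.tailRank (m + 1)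
                = T.r (m + 1) + (T.r (m + 2) + T.tailRank (m + 2 + 1)) := by
              rw [T.tailRank_eq hT (m + 1), T.tailRank_eq hT (m + 1 + 1)]; rfl
            rw [e2] at e1
            push_cast at e1
            linear_combination e1 - hpar - hinc.four_mul h1
          -- If column `k - 1` is irregular, only the values `r` and `r - 2` are sure to be
          -- attainable, its rank being possibly `1`. Up to the shift by 4 they cover the right
          -- parity class.
          have key : ∀ z r : ZMod 8, 4 * z = 4 * r →
              (z = r - 2 * (0 : ℕ) ∨ z = r - 2 * (1 : ℕ)) ∨
              (z - 4 = r - 2 * (0 : ℕ) ∨ z - 4 = r - 2 * (1 : ℕ)) := by decide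
          have hinc' {x : ZMod 8} (h : x = T.r (m + 1) - 2 * (0 : ℕ) ∨
              x = T.r (m + 1) - 2 * (1 : ℕ)) : T.IsIncrement (m + 1) x :=
            ⟨fun h' => absurd h' hr', fun _ =>
              h.elim (fun h => ⟨0, by omega, h⟩) fun h => ⟨1, hr1, h⟩⟩
          rcases key _ _ hx with h | h
          · exact ⟨u, Or.inl rfl, hinc' h⟩
          · refine ⟨u + 4, Or.inr rfl, ?_⟩
            have e : T.sVal m - (q₁ + (u + 4)) = T.sVal m - (q₁ + u) - 4 := by ring
            rw [e]
            exact hinc' h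
      · exact ⟨u, Or.inl rfl, fun m hm hr => (h ⟨m, hm, hr⟩).elim⟩
    obtain ⟨v, hv, hi⟩ := hv
    exact ⟨u, v, hinc, fun h => absurd h hk, fun _ => hv, hu, hi⟩

theorem FullTableau.IsIncrement.exists_kinds {T : FullTableau} (h1 : T.Cond1) {k : ℕ+}
    {u v : ZMod 8} (hu : T.IsIncrement k u) (hv : T.IsRegular k → v = 0)
    (hv' : ¬ T.IsRegular k → v = u ∨ v = u + 4) :
    ∃ (ι : Type) (_ : Fintype ι) (κ : ι → Kind),
      ((∃ i, (κ i).IsOdd) ↔ ¬ T.IsRegular k) ∧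
      ∑ i, (κ i).rank = T.r k ∧ ∑ i, (κ i).u = u ∧ ∑ i, (κ i).v = v := by
  by_cases hk : T.IsRegular k
  · obtain ⟨a, ha⟩ := h1 k hk
    obtain ⟨ι, _, κ, hodd, hr, hsu, hsv⟩ :=
      exists_even_kinds a u (hu.1 hk).1 fun h0 => (hu.1 hk).2 (by omega)
    exact ⟨ι, inferInstance, κ, ⟨fun ⟨i, hi⟩ => (hodd i hi).elim, fun h => absurd hk h⟩,
      hr.trans ha.symm, hsu, hsv.trans (hv hk).symm⟩
  · obtain ⟨p, hp, hup⟩ := hu.2 hk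
    obtain ⟨r, hr⟩ : ∃ r, T.r k = r + 1 :=
      ⟨T.r k - 1, by have := FullTableau.one_le_r hk; omega⟩
    obtain ⟨w, hw, hvw⟩ : ∃ w, (w = 0 ∨ w = 4) ∧ v = u + w := by
      rcases hv' hk with h | h
      · exact ⟨0, Or.inl rfl, by rw [h, add_zero]⟩
      · exact ⟨4, Or.inr rfl, h⟩
    obtain ⟨ι, _, κ, ⟨i⟩, hodd, hrk, hsu, hsv⟩ := exists_odd_kinds r p (by omega) w hw
    rw [hr] at hup
    exact ⟨ι, inferInstance, κ, ⟨fun _ => hk, fun _ => ⟨i, hodd i⟩⟩, hrk.trans hr.symm,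
      hsu.trans hup.symm, by rw [hsv, hvw, hup]⟩

/-- The new blocks at `k` leave every `σ_m` with `m ≥ k` unchanged, apart from the `∞` that odd ones
create at `k`. The invariants `congr` and `parity` persist because `u` and `v` agree modulo 4 and
`u` has the parity of the rank. -/
theorem Realizes.exists_pred {T : FullTableau} (hT : T.IsFinite) (h1 : T.Cond1) (h2 : T.Cond2)
    (h3 : T.Cond3) (h4 : T.Cond4) {k : ℕ+} {ι : Type} [Fintype ι] {B : ι → Block}
    (hB : Realizes T (k + 1) B) :
    ∃ (ι' : Type) (_ : Fintype ι') (B' : ι' → Block), Realizes T k B' := by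
  classical
  obtain ⟨u, v, hinc, hv, hv', hu, hnext⟩ := exists_increments hT h1 h2 h3 h4
    (hB.near k rfl) (fun m hm hr => by subst hm; exact hB.far m rfl hr) hB.congr hB.parity
  obtain ⟨ι', _, κ, hodd, hrank, hsu, hsv⟩ := hinc.exists_kinds h1 hv hv'
  have hlt (i : ι) : k < (B i).k := PNat.add_one_le_iff.mp (hB.le i)
  let B' : ι ⊕ ι' → Block := Sum.elim B fun j => ⟨k, κ j⟩
  have hnearB : ∑ i, (B' i).near k = ∑ i, (B i).far (k + 1) + u := by
    rw [Fintype.sum_sum_type, ← hsu]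
    exact congrArg₂ _ (Finset.sum_congr rfl fun i _ => Block.near_eq_far (hB.le i))
      (Finset.sum_congr rfl fun j _ => Block.near_self ⟨k, κ j⟩)
  have hfarB : ∑ i, (B' i).far k = ∑ i, (B i).near (k + 1) + v := by
    rw [Fintype.sum_sum_type, ← hsv]
    exact congrArg₂ _ (Finset.sum_congr rfl fun i _ => Block.far_eq_near (hB.le i))
      (Finset.sum_congr rfl fun j _ => Block.far_self ⟨k, κ j⟩)
  have hsigB (m : ℕ+) (hm : k ≤ m) : ∑ i, (B' i).sig m = ∑ i, (B i).sig m := by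
    rw [Fintype.sum_sum_type]
    have : ∑ j, (B' (Sum.inr j)).sig m = 0 :=
      Finset.sum_eq_zero fun j _ => Block.sig_of_le (b := ⟨k, κ j⟩) hm
    rw [this, add_zero]; rfl
  have huv : 2 * u = 2 * v := by
    by_cases hk : T.IsRegular k
    · rw [hv hk]; rcases (hinc.1 hk).1 with rfl | rfl <;> decide
    · rcases hv' hk with rfl | rfl
      · rfl
      · have h8 : (8 : ZMod 8) = 0 := by decide
        linear_combination -h8
  refine ⟨ι ⊕ ι', inferInstance, B', ?_⟩
  refine
    { le := ?_, rank := ?_, odd := ?_, sig := ?_, near := ?_, far := ?_, congr := ?_,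
      parity := ?_ }
  · rintro (i | j)
    · exact (hlt i).le
    · exact le_rfl
  · intro m hm
    have hsplit : familyRank B' m = familyRank B m + ∑ j, if k = m then (κ j).rank else 0 := by
      rw [familyRank, Fintype.sum_sum_type]; rfl
    rw [hsplit]
    rcases hm.eq_or_lt with rfl | hm
    · have h0 : familyRank B k = 0 := Finset.sum_eq_zero fun i _ => if_neg (hlt i).ne'
      simp only [h0, if_true, hrank, zero_add]
    · rw [hB.rank m (PNat.add_one_le_iff.mpr hm)]
      simp [hm.ne]
  · intro m hm
    rcases hm.eq_or_lt with rfl | hm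
    · rw [← hodd]
      constructor
      · rintro ⟨i | j, hk, ho⟩
        · exact absurd hk (hlt i).ne'
        · exact ⟨j, ho⟩
      · rintro ⟨j, ho⟩
        exact ⟨Sum.inr j, rfl, ho⟩
    · rw [← hB.odd m (PNat.add_one_le_iff.mpr hm)]
      constructor
      · rintro ⟨i | j, hk, ho⟩
        · exact ⟨i, hk, ho⟩
        · exact absurd hk hm.ne
      · rintro ⟨i, hk, ho⟩
        exact ⟨Sum.inl i, hk, ho⟩
  · intro m hm hr
    rw [hsigB m hm]
    rcases hm.eq_or_lt with rfl | hm
    · rw [hB.near k rfl hr]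
      exact Finset.sum_congr rfl fun i _ => (Block.sig_eq_near (hB.le i)).symm
    · exact hB.sig m (PNat.add_one_le_iff.mpr hm) hr
  · intro m hm hr
    rw [hnearB, hu m hm hr]
  · intro m hm hr
    rw [hfarB]
    exact hnext m hm hr
  · rw [hnearB, hfarB]
    linear_combination huv - hB.congr
  · rw [hnearB, T.tailRank_eq hT k]
    push_cast
    linear_combination hB.parity + hinc.four_mul h1 - 2 * hB.congr

/-- The offset 2 ensures that the columns `N + 1` and `N`, which `near` and `far` inspect, are also
zero. -/
theorem exists_realizes_of_le {T : FullTableau} {N : ℕ+} (hN : ∀ m, N ≤ m → T m = (0, 0)) :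
    ∃ (ι : Type) (_ : Fintype ι) (B : ι → Block), Realizes T (N + 2) B := by
  have hreg (m : ℕ+) (h : N ≤ m) : T.IsRegular m := by
    rw [FullTableau.IsRegular, hN m h]; exact Or.inl rfl
  have hr (m : ℕ+) (h : N ≤ m) : T.r m = 0 := by rw [FullTableau.r, hN m h]
  have hs (m : ℕ+) (h : N ≤ m) : T.sVal m = 0 := by
    rw [FullTableau.sVal, FullTableau.s, hN m h]; rfl
  have hN2 : N ≤ N + 2 := (PNat.lt_add_right N 2).le
  refine ⟨Empty, inferInstance, Empty.elim, ?_⟩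
  refine
    { le := fun i => i.elim
      rank := fun m hm => ?_
      odd := fun m hm => ⟨fun ⟨i, _⟩ => i.elim, fun h => absurd (hreg m (hN2.trans hm)) h⟩
      sig := fun m hm _ => ?_
      near := fun m hm _ => ?_
      far := fun m hm _ => ?_
      congr := by simp
      parity := ?_ }
  · rw [hr m (hN2.trans hm)]; simp [familyRank]
  · rw [hs m (hN2.trans hm)]; simp
  · obtain rfl : m = N + 1 := add_right_cancel (b := 1) hm
    rw [hs _ (PNat.lt_add_right N 1).le]; simp
  · obtain rfl : m = N := add_right_cancel hm
    rw [hs _ le_rfl]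
    simp only [Finset.univ_eq_empty, Finset.sum_empty, sub_zero]
    exact ⟨fun _ => ⟨Or.inl rfl, fun _ => rfl⟩,
      fun h => absurd (hreg _ (PNat.lt_add_right m 1).le) h⟩
  · have : T.tailRank (N + 2) = 0 := by
      rw [FullTableau.tailRank]
      refine finsum_eq_zero_of_forall_eq_zero fun j => ?_
      classical
      rw [finsum_eq_if]
      exact ite_eq_right_iff.mpr fun h => hr j (hN2.trans h)
    rw [this]; simp

theorem exists_blocks_of_conds {T : FullTableau} (hT : T.IsFinite) (h1 : T.Cond1) (h2 : T.Cond2)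
    (h3 : T.Cond3) (h4 : T.Cond4) :
    ∃ (ι : Type) (_ : Fintype ι) (B : ι → Block),
      ∀ m, T m = (familyRank B m, familySig B m) := by
  obtain ⟨N, hN⟩ : ∃ N : ℕ+, ∀ m, N ≤ m → T m = (0, 0) := by
    obtain ⟨M, hM⟩ := hT.bddAbove
    refine ⟨M + 1, fun m hm => ?_⟩
    by_contra h
    exact absurd (hM (show m ∈ Function.support T from h))
      (not_le.mpr (PNat.add_one_le_iff.mp hm))
  have hdesc (k : ℕ+) : (∃ (ι : Type) (_ : Fintype ι) (B : ι → Block), Realizes T k B) →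
      ∃ (ι : Type) (_ : Fintype ι) (B : ι → Block), Realizes T 1 B := by
    induction k using PNat.recOn with
    | one => exact id
    | succ k ih =>
      rintro ⟨ι, _, B, hB⟩
      exact ih (hB.exists_pred hT h1 h2 h3 h4)
  obtain ⟨ι, _, B, hB⟩ := hdesc _ (exists_realizes_of_le hN)
  refine ⟨ι, inferInstance, B, fun m => Prod.ext (hB.rank m (one_le)).symm ?_⟩
  change T.s m = familySig B m
  rw [familySig]
  by_cases hm : T.IsRegular m
  · rw [if_neg fun h => (hB.odd m (one_le)).mp h hm, (h2.sVal_spec hm).1,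
      hB.sig m (one_le) hm]
  · rw [if_pos ((hB.odd m (one_le)).mpr hm), FullTableau.s_eq_top hm]

end

end Enlacement

open Enlacement in
theorem mainTheorem1 (T : Enlacement.FullTableau) (hT : T.IsFinite) :
    T.Admissible ↔ T.Cond1 ∧ T.Cond2 ∧ T.Cond3 ∧ T.Cond4 := by
  rw [admissible_iff_exists_blocks]
  constructor
  · rintro ⟨ι, _, B, hB⟩
    exact ⟨cond1_of_blocks hB, cond2_of_blocks hB, cond3_of_blocks hB, cond4_of_blocks hB⟩
  · rintro ⟨h1, h2, h3, h4⟩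
    exact exists_blocks_of_conds hT h1 h2 h3 h4
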